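/- Lemma 2.2. Let $n$ and $m$ be positive integers and let $D$ be a triangulated $n$-disc, that is, a finite simplicial complex whose geometric realization is homeomorphic to the closed unit ball in $\mathbb{R}^n$. Then there is a triangulation $S$ of the $n$-sphere $S^n$ (a finite simplicial complex whose geometric realization is homeomorphic to $S^n$) that contains two disjoint oppositely oriented copies of $D$, together with at least $m$ additional $n$-simplices. That is, there are simplicial isomorphisms $f$ and $g$ from $D$ onto subcomplexes $f(D)$ and $g(D)$ of $S$ such that $f(D)$ and $g(D)$ are disjoint (have no vertex in common); for an orientation of $S$ (a choice of orientations of its $n$-simplices such that any two $n$-simplices sharing an $(n-1)$-simplex induce opposite orientations on it), the orientations of the $n$-simplices of $D$ pulled back through $f$ and through $g$ are opposite; and at least $m$ of the $n$-simplices of $S$ belong to neither $f(D)$ nor $g(D)$. -/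

import Mathlib

/-- The geometric realization of a finite abstract simplicial complex `K` with vertex set `V`,
in barycentric coordinates: the union, over the faces `s` of `K`, of the simplices spanned by the
unit vectors `e_v`, `v ∈ s`, with the topology inherited from `ℝ^V`. -/
def realization {V : Type*} [Fintype V] (K : AbstractSimplicialComplex V) : Set (V → ℝ) :=
  {x | x ∈ stdSimplex ℝ V ∧ ∃ s ∈ K.faces, ∀ v, v ∉ s → x v = 0}

/-- `K` is a triangulated `n`-disc: its realization is homeomorphic to the closed unit ball
of `ℝ^n`. -/
def IsTriangulatedDisc (n : ℕ) {V : Type*} [Fintype V] (K : AbstractSimplicialComplex V) : Prop :=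
  Nonempty (realization K ≃ₜ Metric.closedBall (0 : EuclideanSpace ℝ (Fin n)) 1)

/-- `K` is a triangulation of the `n`-sphere: its realization is homeomorphic to the unit sphere
of `ℝ^(n+1)`. -/
def IsTriangulatedSphere (n : ℕ) {V : Type*} [Fintype V] (K : AbstractSimplicialComplex V) :
    Prop :=
  Nonempty (realization K ≃ₜ Metric.sphere (0 : EuclideanSpace ℝ (Fin (n + 1))) 1)

/-- `t 0, …, t n` are the vertices, without repetition, of an `n`-simplex of `K`. -/
def IsOrderedSimplex {V : Type*} (K : AbstractSimplicialComplex V) {n : ℕ} (t : Fin (n + 1) → V) :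
    Prop :=
  Function.Injective t ∧ ∃ s ∈ K.faces, (s : Set V) = Set.range t

/-- `o` is a (coherent) orientation of the `n`-dimensional complex `K`: it gives a sign to each
ordering of the vertices of each `n`-simplex (only these values of `o` matter), a permutation of
the vertices multiplies the sign by the sign of the permutation, and two different `n`-simplices
that share an `(n-1)`-simplex induce opposite orientations on it. -/
structure IsOrientation {V : Type*} (K : AbstractSimplicialComplex V) (n : ℕ)
    (o : (Fin (n + 1) → V) → ℤˣ) : Prop where
  perm : ∀ t : Fin (n + 1) → V, IsOrderedSimplex K t →
    ∀ σ : Equiv.Perm (Fin (n + 1)), o (t ∘ σ) = Equiv.Perm.sign σ * o t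
  coherent : ∀ (t : Fin n → V) (a b : V), a ≠ b →
    IsOrderedSimplex K (Fin.cons a t : Fin (n + 1) → V) →
    IsOrderedSimplex K (Fin.cons b t : Fin (n + 1) → V) →
    o (Fin.cons a t) = -o (Fin.cons b t)

/-- The injective vertex map `f` is a simplicial isomorphism of `D` onto a subcomplex of `S`,
that is, a copy of `D` in `S`. -/
def IsCopy {V W : Type*} (D : AbstractSimplicialComplex V) (S : AbstractSimplicialComplex W)
    (f : V ↪ W) : Prop :=
  ∀ s ∈ D.faces, s.map f ∈ S.faces

/-- The copies `f` and `g` in `S` of the `n`-dimensional complex `D` are oppositely oriented: some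
orientation of `S` induces through `f` and through `g` opposite orientations on all `n`-simplices
of `D`. (If `S` triangulates a sphere of positive dimension then it has exactly two orientations,
negatives of each other, so that the choice of the orientation is immaterial.) -/
def OppositelyOriented {V W : Type*} (n : ℕ) (D : AbstractSimplicialComplex V)
    (S : AbstractSimplicialComplex W) (f g : V ↪ W) : Prop :=
  ∃ o : (Fin (n + 1) → W) → ℤˣ, IsOrientation S n o ∧
    ∀ t : Fin (n + 1) → V, IsOrderedSimplex D t → o (g ∘ t) = -o (f ∘ t)

/-- The `n`-simplices of `S` that lie in neither of the copies `f` and `g` of `D`. -/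
def additionalSimplices {V W : Type*} (n : ℕ) (D : AbstractSimplicialComplex V)
    (S : AbstractSimplicialComplex W) (f g : V ↪ W) : Set (Finset W) :=
  {s | s ∈ S.faces ∧ s.card = n + 1 ∧ (∀ d ∈ D.faces, d.map f ≠ s) ∧ ∀ d ∈ D.faces, d.map g ≠ s}

/-! The sphere is the boundary of the prism `D × [0, m]`. The ends `D × {0}` and `D × {m}` keep the
triangulation of `D`. The side, over the boundary of `D`, is cut into `m` unit layers, and each
layer is triangulated by staircase simplices with respect to a linear order on the vertices. The max
norm makes the unit sphere of `ℝ^n × ℝ` the boundary of the cylinder over the ball, so a chart of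
`D` carries the prism boundary onto it (`isChart_prismChart`), and radial projection rounds it off.
The ends are disjoint copies of `D` exchanged by the reflection of the last coordinate, and each
layer over one boundary `(n-1)`-simplex has an `n`-simplex that meets two levels, hence lies in
neither end.

The chart of `D` is merely continuous, so two points need genuine topology: that the part of `D`
sent to the boundary sphere is a subcomplex containing an `(n-1)`-simplex, and that the triangulated
sphere is orientable with the ends oppositely oriented. Both rest on a degree theory built from
integration. The degree of a continuous map is read off from smooth approximations as the integral
of the pullback of a bump form, and the divergence theorem makes it a homotopy invariant
(`bumpIntegral_eq_of_homotopy`). An injective map has nonzero degree (`HasDegree.ne_zero`), since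
otherwise its composite with a left inverse, the identity, would have degree zero. Invariance of
domain and of dimension follow.

By invariance of domain, whether a point of `D` goes to the boundary depends only on the open
simplex containing it (`norm_lt_one_of_weightSupport_eq`); by invariance of dimension, some boundary
face has `n` vertices. An ordered `n`-simplex is given the sign of the local degree of the cone over
the chart. The cones over two adjacent simplices glue to one injective map, with a reflection on one
side, which gives coherence (`isOrientation_simplexSign`). The reflection that swaps the ends
reverses the sign (`simplexSign_of_reflection`). -/

open Metric MeasureTheory Set Filter Topology
open scoped ContDiff

/-! ### The bump form and closedness of its pullbacks -/

/-- A smooth radial bump function on `ℝ^N`, supported in the closed Euclidean unit ball. -/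
noncomputable def euclideanBump {N : ℕ} (y : Fin N → ℝ) : ℝ :=
  Real.smoothTransition (1 - ∑ i, y i ^ 2)

theorem euclideanBump_contDiff {N : ℕ} {k : ℕ∞} : ContDiff ℝ k (euclideanBump (N := N)) := by
  unfold euclideanBump
  exact Real.smoothTransition.contDiff.comp (by fun_prop)

theorem euclideanBump_nonneg {N : ℕ} (y : Fin N → ℝ) : 0 ≤ euclideanBump y :=
  Real.smoothTransition.nonneg _

/-- The norm here is the sup norm, which is at most the Euclidean one. The bump itself is Euclidean
so that it is smooth and invariant under signed permutations of the coordinates. -/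
theorem euclideanBump_eq_zero {N : ℕ} {y : Fin N → ℝ} (hy : 1 ≤ ‖y‖) : euclideanBump y = 0 := by
  refine Real.smoothTransition.zero_of_nonpos ?_
  by_contra! h
  have hlt : ‖y‖ < 1 := by
    rw [pi_norm_lt_iff one_pos]
    intro i
    have h1 : y i ^ 2 ≤ ∑ j, y j ^ 2 :=
      Finset.single_le_sum (f := fun j => y j ^ 2) (fun j _ => sq_nonneg _) (Finset.mem_univ i)
    rw [Real.norm_eq_abs, abs_lt]
    constructor <;> nlinarith
  linarith

/-- The determinant as a continuous alternating form on `ℝ^N`. -/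
noncomputable def volumeForm (N : ℕ) : (Fin N → ℝ) [⋀^Fin N]→L[ℝ] ℝ :=
  { Matrix.detRowAlternating (n := Fin N) (R := ℝ) with
    cont := by
      change Continuous fun M : Matrix (Fin N) (Fin N) ℝ => M.det
      fun_prop }

theorem volumeForm_apply {N : ℕ} (v : Fin N → Fin N → ℝ) :
    volumeForm N v = (Matrix.of v).det := rfl

theorem volumeForm_map_single {N : ℕ} (A : (Fin N → ℝ) →L[ℝ] (Fin N → ℝ)) :
    volumeForm N (fun j => A (Pi.single j 1)) = A.det := by
  rw [volumeForm_apply, ← Matrix.det_transpose, ContinuousLinearMap.det, ← LinearMap.det_toMatrix']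
  congr 1

theorem continuousAlternatingMap_eq_zero_of_succ {N : ℕ}
    (w : (Fin N → ℝ) [⋀^Fin (N + 1)]→L[ℝ] ℝ) : w = 0 := by
  ext v
  refine w.toAlternatingMap.map_linearDependent v fun h => ?_
  have := h.fintype_card_le_finrank
  simp at this

/-- Closedness of the pullback of an `N`-form of `ℝ^N` to `ℝ^(N+1)`, in coordinates. -/
theorem sum_fderiv_pullback_eq_zero {N : ℕ} {F : (Fin (N + 1) → ℝ) → (Fin N → ℝ)}
    (hF : ContDiff ℝ 2 F) (z : Fin (N + 1) → ℝ) :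
    ∑ i : Fin (N + 1), fderiv ℝ (fun z => (-1) ^ (i : ℕ) * (euclideanBump (F z) *
      volumeForm N fun j => fderiv ℝ F z (Pi.single (i.succAbove j) 1))) z (Pi.single i 1) = 0 := by
  set η : (Fin N → ℝ) → (Fin N → ℝ) [⋀^Fin N]→L[ℝ] ℝ := fun y => euclideanBump y • volumeForm N
  have hb : ∀ y, DifferentiableAt ℝ (euclideanBump (N := N)) y := fun y =>
    (euclideanBump_contDiff (k := 1)).differentiable (by norm_num) y
  have hη : DifferentiableAt ℝ η (F z) := (hb _).smul_const _
  have hdF : DifferentiableAt ℝ (fderiv ℝ F) z :=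
    (hF.fderiv_right (m := 1) (by norm_num)).differentiable (by norm_num) z
  -- The exterior derivative commutes with pullback, and the derivative of an `N`-form on `ℝ^N` is
  -- an `(N+1)`-form there, hence zero.
  have hpb := extDeriv_pullback (x := z) hη hF.contDiffAt (by simp)
  rw [continuousAlternatingMap_eq_zero_of_succ (extDeriv η (F z))] at hpb
  have hd : DifferentiableAt ℝ
      (fun x => (η (F x)).compContinuousLinearMap (fderiv ℝ F x)) z := by
    refine DifferentiableAt.continuousAlternatingMapCompContinuousLinearMap ?_ hdF
    exact DifferentiableAt.comp z hη (hF.differentiable (by norm_num) z)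
  have h0 := congrArg (fun w => w (fun i => Pi.single i (1 : ℝ))) hpb
  simp only [extDeriv_apply hd] at h0
  refine Eq.trans ?_ (h0.trans (by simp))
  refine Finset.sum_congr rfl fun i _ => ?_
  have hfun : (fun x => (-1 : ℝ) ^ (i : ℕ) * (euclideanBump (F x) *
      volumeForm N fun j => fderiv ℝ F x (Pi.single (i.succAbove j) 1)))
      = fun x => (-1 : ℝ) ^ (i : ℕ) * (((η (F x)).compContinuousLinearMap (fderiv ℝ F x))
        (fun j => Pi.single (i.succAbove j) (1 : ℝ))) := by
    funext x
    simp [η, Function.comp_def]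
  have hd' : DifferentiableAt ℝ (fun x => ((η (F x)).compContinuousLinearMap (fderiv ℝ F x))
        (fun j => Pi.single (i.succAbove j) (1 : ℝ))) z := by
    fun_prop
  rw [hfun, fderiv_const_mul hd', _root_.smul_apply, smul_eq_mul, zsmul_eq_mul]
  push_cast
  rfl

/-! ### The degree integral and its homotopy invariance -/

/-- The integral of the pullback of the bump form: a multiple of the degree at `0`. -/
noncomputable def bumpIntegral {N : ℕ} (p : Fin N → ℝ) (r : ℝ) (u : (Fin N → ℝ) → Fin N → ℝ) : ℝ :=
  ∫ x in closedBall p r, euclideanBump (u x) * (fderiv ℝ u x).det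

theorem pi_closedBall_eq_Icc {N : ℕ} (p : Fin N → ℝ) {r : ℝ} (hr : 0 ≤ r) :
    closedBall p r = Icc (fun i => p i - r) (fun i => p i + r) := by
  rw [closedBall_pi p hr, ← Set.pi_univ_Icc]
  simp [Real.closedBall_eq_Icc]

/-- Stokes on the box `[0, 1] × closedBall p r`; balls of the sup norm are cubes. The pulled-back
form is closed, it vanishes on the side faces because the homotopy stays outside the support of the
bump there, and the two remaining faces give the two integrals. -/
theorem bumpIntegral_eq_of_homotopy {N : ℕ} {p : Fin N → ℝ} {r : ℝ} (hr : 0 < r)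
    {u₀ u₁ : (Fin N → ℝ) → Fin N → ℝ} (h₀ : ContDiff ℝ 2 u₀) (h₁ : ContDiff ℝ 2 u₁)
    (H : ∀ t ∈ Icc (0 : ℝ) 1, ∀ x ∈ sphere p r, 1 ≤ ‖(1 - t) • u₀ x + t • u₁ x‖) :
    bumpIntegral p r u₀ = bumpIntegral p r u₁ := by
  set F : (Fin (N + 1) → ℝ) → Fin N → ℝ :=
    fun z => (1 - z 0) • u₀ (fun i => z i.succ) + z 0 • u₁ (fun i => z i.succ) with hFdef
  have hF : ContDiff ℝ 2 F := by fun_prop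
  set G : Fin (N + 1) → (Fin (N + 1) → ℝ) → ℝ := fun i z => (-1) ^ (i : ℕ) * (euclideanBump (F z) *
      volumeForm N fun j => fderiv ℝ F z (Pi.single (i.succAbove j) 1)) with hG
  have hGc : ∀ i, ContDiff ℝ 1 (G i) := by
    intro i
    have h1 : ContDiff ℝ 1 fun z => euclideanBump (F z) :=
      (euclideanBump_contDiff (k := 1)).comp (hF.of_le (by norm_num))
    have h2 : ContDiff ℝ 1 (fderiv ℝ F) := hF.fderiv_right (by norm_num)
    have h3 : ContDiff ℝ 1 fun z =>
        volumeForm N fun j => fderiv ℝ F z (Pi.single (i.succAbove j) 1) := by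
      simp only [volumeForm_apply, Matrix.det_apply]
      simp only [Matrix.of_apply]
      refine ContDiff.sum fun σ _ => ?_
      refine ContDiff.const_smul _ (contDiff_prod fun j _ => ?_)
      have : ContDiff ℝ 1 fun z => fderiv ℝ F z (Pi.single (i.succAbove (σ j)) 1) :=
        h2.clm_apply contDiff_const
      exact contDiff_pi.1 this j
    exact contDiff_const.mul (h1.mul h3)
  set a : Fin (N + 1) → ℝ := Fin.cons 0 (fun i => p i - r)
  set b : Fin (N + 1) → ℝ := Fin.cons 1 (fun i => p i + r)
  have hab : a ≤ b := by
    intro i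
    refine Fin.cases ?_ (fun j => ?_) i
    · simp [a, b]
    · simp [a, b]; linarith
  have hsum : ∀ z, ∑ i, fderiv ℝ (G i) z (Pi.single i 1) = 0 := sum_fderiv_pullback_eq_zero hF
  have key := integral_divergence_of_hasFDerivAt_off_countable' a b hab G (fun i => fderiv ℝ (G i)) ∅
    countable_empty (fun i => (hGc i).continuous.continuousOn)
    (fun z _ i => ((hGc i).differentiable (by norm_num) z).hasFDerivAt)
    (by simp only [hsum]; exact integrableOn_zero)
  simp only [hsum, integral_zero, Fin.sum_univ_succ] at key
  -- On a side face the point of `ℝ^N` lies on the sphere, where `H` applies and the bump vanishes.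
  have hside : ∀ i : Fin N, ∀ c, (c = p i - r ∨ c = p i + r) →
      ∫ x in Icc (a ∘ i.succ.succAbove) (b ∘ i.succ.succAbove), G i.succ (i.succ.insertNth c x) = 0 := by
    intro i c hc
    refine setIntegral_eq_zero_of_forall_eq_zero fun x hx => ?_
    have hz : euclideanBump (F (i.succ.insertNth c x)) = 0 := by
      have hmem : (i.succ.insertNth c x : Fin (N + 1) → ℝ) ∈ Icc a b := by
        refine Fin.insertNth_mem_Icc.2 ⟨?_, hx⟩
        rcases hc with rfl | rfl <;> simp [a, b] <;> linarith
      have hi : (i.succ.insertNth c x : Fin (N + 1) → ℝ) i.succ = c := by simp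
      generalize (i.succ.insertNth c x : Fin (N + 1) → ℝ) = z at hmem hi
      refine euclideanBump_eq_zero (H _ ⟨hmem.1 0, hmem.2 0⟩ _ ?_)
      have hball : (fun i => z i.succ) ∈ closedBall p r := by
        rw [pi_closedBall_eq_Icc p hr.le]
        exact ⟨fun j => hmem.1 j.succ, fun j => hmem.2 j.succ⟩
      refine le_antisymm hball ?_
      have := dist_le_pi_dist (fun i => z i.succ) p i
      refine le_trans ?_ this
      rw [Real.dist_eq]
      rcases hc with hc | hc <;> rw [hi, hc] <;> simp [abs_of_pos hr]
    simp [hG, hz]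
  have hface : ∀ (c : ℝ) (u : (Fin N → ℝ) → Fin N → ℝ), ContDiff ℝ 2 u → (∀ x, F (Fin.cons c x) = u x) →
      ∫ x in Icc (a ∘ (0 : Fin (N + 1)).succAbove) (b ∘ (0 : Fin (N + 1)).succAbove),
        G 0 ((0 : Fin (N + 1)).insertNth c x) = bumpIntegral p r u := by
    intro c u hu hcu
    have hI : Icc (a ∘ (0 : Fin (N + 1)).succAbove) (b ∘ (0 : Fin (N + 1)).succAbove)
        = closedBall p r := by
      rw [pi_closedBall_eq_Icc p hr.le]
      rfl
    rw [hI, bumpIntegral]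
    refine setIntegral_congr_fun isClosed_closedBall.measurableSet fun x _ => ?_
    have hins : (0 : Fin (N + 1)).insertNth c x = (Fin.cons c x : Fin (N + 1) → ℝ) := by
      simp
    have hder : ∀ j : Fin N, fderiv ℝ F (Fin.cons c x) (Pi.single ((0 : Fin (N + 1)).succAbove j) 1)
        = fderiv ℝ u x (Pi.single j 1) := by
      intro j
      have hcons : HasFDerivAt (fun y : Fin N → ℝ => (Fin.cons c y : Fin (N + 1) → ℝ))
          (ContinuousLinearMap.pi fun k : Fin (N + 1) =>
            (Fin.cases 0 (fun l => ContinuousLinearMap.proj l) k : (Fin N → ℝ) →L[ℝ] ℝ)) x := by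
        refine hasFDerivAt_pi.2 fun k => ?_
        refine Fin.cases ?_ (fun l => ?_) k
        · simpa using hasFDerivAt_const c x
        · simpa using hasFDerivAt_apply l x
      have hcomp := ((hF.differentiable (by norm_num) (Fin.cons c x)).hasFDerivAt).comp x hcons
      have hFu : F ∘ (fun y : Fin N → ℝ => (Fin.cons c y : Fin (N + 1) → ℝ)) = u := funext hcu
      rw [hFu] at hcomp
      rw [hcomp.fderiv, ContinuousLinearMap.comp_apply]
      congr 1
      funext k
      refine Fin.cases ?_ (fun l => ?_) k
      · simp
      · simp [Pi.single_apply, Fin.succ_inj]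
    simp only [hG, hins, hcu, ← volumeForm_map_single, hder]
    simp
  rw [hface (b 0) u₁ h₁ (fun x => by simp [F, b]), hface (a 0) u₀ h₀ (fun x => by simp [F, a]),
    Finset.sum_eq_zero, add_zero] at key
  · linarith
  · intro i _
    rw [hside i (b i.succ) (Or.inr rfl), hside i (a i.succ) (Or.inl rfl), sub_zero]

/-! ### The degree of a continuous map -/

/-- `d` is (a fixed multiple of) the degree over `y` of every map that is uniformly `ε`-close to
`φ` on a ball, as computed with bump forms of width at most `ε`. -/
def HasDegreeScale {N : ℕ} (φ : (Fin N → ℝ) → Fin N → ℝ) (p : Fin N → ℝ) (r : ℝ) (y : Fin N → ℝ)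
    (ε d : ℝ) : Prop :=
  ∀ η, 0 < η → η ≤ ε → ∀ f : (Fin N → ℝ) → Fin N → ℝ, ContDiff ℝ 2 f →
    (∀ x ∈ closedBall p r, ‖f x - φ x‖ ≤ ε) →
      bumpIntegral p r (fun x => η⁻¹ • (f x - y)) = d

/-- `d` is (a fixed multiple of) the degree over `y` of `φ` on the closed ball of radius `r`
around `p`. -/
def HasDegree {N : ℕ} (φ : (Fin N → ℝ) → Fin N → ℝ) (p : Fin N → ℝ) (r : ℝ) (y : Fin N → ℝ)
    (d : ℝ) : Prop :=
  ∃ ε, 0 < ε ∧ HasDegreeScale φ p r y ε d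

section
variable {N : ℕ} {φ : (Fin N → ℝ) → Fin N → ℝ} {p y : Fin N → ℝ} {r ε d : ℝ}

theorem HasDegreeScale.mono (h : HasDegreeScale φ p r y ε d) {ε' : ℝ} (hε : ε' ≤ ε) :
    HasDegreeScale φ p r y ε' d :=
  fun η h0 hη f hf hfφ => h η h0 (hη.trans hε) f hf fun x hx => (hfφ x hx).trans hε

/-- Tietze extension to the whole space, then smooth approximation there. -/
theorem exists_contDiff_approx_on_closedBall (hφ : ContinuousOn φ (closedBall p r)) (hε : 0 < ε) :
    ∃ f : (Fin N → ℝ) → Fin N → ℝ, ContDiff ℝ 2 f ∧ ∀ x ∈ closedBall p r, ‖f x - φ x‖ ≤ ε := by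
  obtain ⟨g, hg⟩ := ContinuousMap.exists_restrict_eq (isClosed_closedBall (x := p) (ε := r))
    (⟨(closedBall p r).domRestrict φ, hφ.domRestrict⟩ : C(closedBall p r, Fin N → ℝ))
  obtain ⟨f, hf, hfg, -⟩ := g.continuous.exists_contDiff_approx 2 (continuous_const (y := ε))
    (fun _ => hε)
  refine ⟨f, hf, fun x hx => ?_⟩
  have : g x = φ x := congrArg (fun k : C(closedBall p r, Fin N → ℝ) => k ⟨x, hx⟩) hg
  rw [← this, ← dist_eq_norm]
  exact (hfg x).le

theorem IsCompact.exists_pos_le_norm_sub {E F : Type*} [TopologicalSpace E] [NormedAddCommGroup F]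
    {K : Set E} (hK : IsCompact K) {φ : E → F} (hφ : ContinuousOn φ K) {y : F}
    (hy : ∀ x ∈ K, φ x ≠ y) : ∃ ε > 0, ∀ x ∈ K, ε ≤ ‖φ x - y‖ := by
  rcases K.eq_empty_or_nonempty with rfl | hne
  · exact ⟨1, one_pos, by simp⟩
  · obtain ⟨x, hx, hmin⟩ := hK.exists_isMinOn hne (f := fun x => ‖φ x - y‖) (by fun_prop)
    exact ⟨‖φ x - y‖, norm_pos_iff.2 (sub_ne_zero.2 (hy x hx)), fun z hz => hmin hz⟩

/-- Two rescaled approximations are joined by a straight homotopy. On the sphere `φ x - y` has norm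
at least `3 * ε` and the errors cost at most `ε`, so the margin left, at least `ε` in scale, keeps
the homotopy outside the bump even when the two widths differ. -/
theorem HasDegreeScale.exists (hr : 0 < r) (hφ : ContinuousOn φ (closedBall p r)) (hε : 0 < ε)
    (h : ∀ x ∈ sphere p r, 3 * ε ≤ ‖φ x - y‖) : ∃ d, HasDegreeScale φ p r y ε d := by
  obtain ⟨f₀, hf₀, hf₀φ⟩ := exists_contDiff_approx_on_closedBall hφ hε
  refine ⟨bumpIntegral p r (fun x => ε⁻¹ • (f₀ x - y)), fun η hη hηε f hf hfφ => ?_⟩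
  refine bumpIntegral_eq_of_homotopy hr (by fun_prop) (by fun_prop) fun t ht x hx => ?_
  have hxb := sphere_subset_closedBall hx
  obtain ⟨ht0, ht1⟩ := ht
  have hle : ε⁻¹ ≤ η⁻¹ := inv_anti₀ hη hηε
  have hε' : 0 < ε⁻¹ := inv_pos.2 hε
  set a := (1 - t) * η⁻¹
  set b := t * ε⁻¹
  have ha : 0 ≤ a := by have : 0 < η⁻¹ := inv_pos.2 hη; exact mul_nonneg (by linarith) this.le
  have hb : 0 ≤ b := by positivity
  have hab : ε⁻¹ ≤ a + b := by
    have := mul_le_mul_of_nonneg_left hle (sub_nonneg.2 ht1)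
    simp only [a, b]; linarith
  have heq : (1 - t) • η⁻¹ • (f x - y) + t • ε⁻¹ • (f₀ x - y)
      = (a + b) • (φ x - y) + (a • (f x - φ x) + b • (f₀ x - φ x)) := by
    simp only [a, b]; module
  rw [heq]
  have h1 : ‖a • (f x - φ x) + b • (f₀ x - φ x)‖ ≤ (a + b) * ε := by
    refine (norm_add_le _ _).trans ?_
    rw [norm_smul, norm_smul, Real.norm_of_nonneg ha, Real.norm_of_nonneg hb, add_mul]
    exact add_le_add (mul_le_mul_of_nonneg_left (hfφ x hxb) ha)
      (mul_le_mul_of_nonneg_left (hf₀φ x hxb) hb)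
  have h2 : (a + b) * (3 * ε) ≤ ‖(a + b) • (φ x - y)‖ := by
    rw [norm_smul, Real.norm_of_nonneg (by positivity)]
    exact mul_le_mul_of_nonneg_left (h x hx) (by positivity)
  have h3 : 1 ≤ (a + b) * ε := by
    calc (1 : ℝ) = ε⁻¹ * ε := by field_simp
      _ ≤ _ := by gcongr
  have h4 := norm_sub_le_norm_add ((a + b) • (φ x - y)) (a • (f x - φ x) + b • (f₀ x - φ x))
  linarith

theorem HasDegree.exists (hr : 0 < r) (hφ : ContinuousOn φ (closedBall p r))
    (h : ∀ x ∈ sphere p r, φ x ≠ y) : ∃ d, HasDegree φ p r y d := by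
  obtain ⟨ε, hε, H⟩ := (isCompact_sphere p r).exists_pos_le_norm_sub
    (hφ.mono sphere_subset_closedBall) h
  obtain ⟨d, hd⟩ := HasDegreeScale.exists (y := y) hr hφ (ε := ε / 3) (by positivity)
    (fun x hx => by linarith [H x hx])
  exact ⟨d, _, by positivity, hd⟩

theorem HasDegree.unique (hφ : ContinuousOn φ (closedBall p r)) {d' : ℝ}
    (h : HasDegree φ p r y d) (h' : HasDegree φ p r y d') : d = d' := by
  obtain ⟨ε, hε, h⟩ := h
  obtain ⟨ε', hε', h'⟩ := h'
  have hm : 0 < min ε ε' := lt_min hε hε'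
  obtain ⟨f, hf, hfφ⟩ := exists_contDiff_approx_on_closedBall hφ hm
  rw [← (h.mono (min_le_left _ _)) _ hm le_rfl f hf hfφ,
    ← (h'.mono (min_le_right _ _)) _ hm le_rfl f hf hfφ]

/-- Moving the target point is the same as translating the approximation, which uses up half of the
tolerance. -/
theorem HasDegreeScale.translate (h : HasDegreeScale φ p r y ε d) {y' : Fin N → ℝ}
    (hy : ‖y - y'‖ ≤ ε / 2) : HasDegreeScale φ p r y' (ε / 2) d := by
  intro η hη hηε f hf hfφ
  have hε : 0 < ε / 2 := hη.trans_le hηε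
  rw [← h η hη (by linarith) (fun x => f x + (y - y')) (by fun_prop) fun x hx => ?_]
  · congr 1; funext x; congr 1; abel
  · calc ‖f x + (y - y') - φ x‖ = ‖(f x - φ x) + (y - y')‖ := by congr 1; abel
      _ ≤ ε / 2 + ε / 2 := (norm_add_le _ _).trans (add_le_add (hfφ x hx) hy)
      _ = ε := by ring

theorem HasDegree.eventually (h : HasDegree φ p r y d) : ∀ᶠ y' in 𝓝 y, HasDegree φ p r y' d := by
  obtain ⟨ε, hε, h⟩ := h
  filter_upwards [closedBall_mem_nhds y (half_pos hε)] with y' hy'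
  refine ⟨ε / 2, half_pos hε, h.translate ?_⟩
  rwa [← dist_eq_norm, dist_comm]

/-- The approximations stay at distance at least `ε` from `y`, outside the support of a bump of
width `η ≤ ε`, so the integrand is identically zero. -/
theorem HasDegreeScale.of_forall_le (h : ∀ x ∈ closedBall p r, 2 * ε ≤ ‖φ x - y‖) :
    HasDegreeScale φ p r y ε 0 := by
  intro η hη hηε f hf hfφ
  refine setIntegral_eq_zero_of_forall_eq_zero fun x hx => ?_
  rw [euclideanBump_eq_zero, zero_mul]
  have h1 := norm_sub_norm_le (φ x - y) (φ x - f x)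
  rw [norm_sub_rev (φ x) (f x), sub_sub_sub_cancel_left] at h1
  rw [norm_smul, norm_inv, Real.norm_of_nonneg hη.le, inv_mul_eq_div, le_div_iff₀ hη]
  linarith [h x hx, hfφ x hx]

theorem HasDegree.of_notMem_image (hφ : ContinuousOn φ (closedBall p r))
    (h : ∀ x ∈ closedBall p r, φ x ≠ y) : HasDegree φ p r y 0 := by
  obtain ⟨ε, hε, H⟩ := (isCompact_closedBall p r).exists_pos_le_norm_sub hφ h
  exact ⟨ε / 2, half_pos hε, .of_forall_le fun x hx => by linarith [H x hx]⟩

/-- Excision: off the smaller ball `φ` keeps a positive distance from `y`, so for a fine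
approximation the integrand vanishes there. -/
theorem HasDegree.restrict (hφ : ContinuousOn φ (closedBall p r)) {p' : Fin N → ℝ} {r' : ℝ}
    (hr' : 0 < r') (hsub : closedBall p' r' ⊆ closedBall p r)
    (hne : ∀ x ∈ closedBall p r, x ∉ ball p' r' → φ x ≠ y) (h : HasDegree φ p r y d) :
    HasDegree φ p' r' y d := by
  obtain ⟨d', hd'⟩ := HasDegree.exists (y := y) hr' (hφ.mono hsub) fun x hx =>
    hne x (hsub (sphere_subset_closedBall hx)) (by simp [mem_sphere.1 hx])
  suffices d = d' by rwa [this]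
  obtain ⟨ε₁, hε₁, h⟩ := h
  obtain ⟨ε₂, hε₂, h'⟩ := hd'
  obtain ⟨ε₃, hε₃, H⟩ := ((isCompact_closedBall p r).diff (isOpen_ball (x := p') (ε := r'))
    ).exists_pos_le_norm_sub (hφ.mono sdiff_subset) (y := y) (fun x hx => hne x hx.1 hx.2)
  set ε := min ε₁ (min ε₂ (ε₃ / 2))
  have hε : 0 < ε := lt_min hε₁ (lt_min hε₂ (half_pos hε₃))
  have hle₁ : ε ≤ ε₁ := min_le_left _ _
  have hle₂ : ε ≤ ε₂ := (min_le_right _ _).trans (min_le_left _ _)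
  have hle₃ : ε ≤ ε₃ / 2 := (min_le_right _ _).trans (min_le_right _ _)
  obtain ⟨f, hf, hfφ⟩ := exists_contDiff_approx_on_closedBall hφ hε
  rw [← h.mono hle₁ ε hε le_rfl f hf hfφ,
    ← h'.mono hle₂ ε hε le_rfl f hf fun x hx => hfφ x (hsub hx)]
  refine (setIntegral_eq_of_subset_of_forall_sdiff_eq_zero
    isClosed_closedBall.measurableSet hsub fun x hx => ?_)
  rw [euclideanBump_eq_zero, zero_mul]
  have h1 := norm_sub_norm_le (φ x - y) (φ x - f x)
  rw [norm_sub_rev (φ x) (f x), sub_sub_sub_cancel_left] at h1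
  rw [norm_smul, norm_inv, Real.norm_of_nonneg hε.le, inv_mul_eq_div, le_div_iff₀ hε]
  linarith [H x ⟨hx.1, fun hb => hx.2 (ball_subset_closedBall hb)⟩, hfφ x hx.1]

theorem det_fderiv_smul_sub {f : (Fin N → ℝ) → Fin N → ℝ} (hf : Differentiable ℝ f) (c : ℝ)
    (y x : Fin N → ℝ) :
    (fderiv ℝ (fun x => c • (f x - y)) x).det = c ^ N * (fderiv ℝ f x).det := by
  rw [fderiv_fun_const_smul ((hf x).sub_const y), fderiv_sub_const]
  simp [ContinuousLinearMap.det]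

/-- The identity is its own smooth approximation, and its integrand is nonnegative, continuous and
positive at `p`. -/
theorem HasDegree.id_pos (hr : 0 < r) : ∃ d > 0, HasDegreeScale (fun x => x) p r p (r / 3) d := by
  obtain ⟨d, hd⟩ := HasDegreeScale.exists (φ := fun x => x) (y := p) hr (by fun_prop)
    (ε := r / 3) (by positivity) (fun x hx => by rw [mem_sphere_iff_norm.1 hx]; linarith)
  refine ⟨d, ?_, hd⟩
  rw [← hd (r / 3) (by positivity) le_rfl (fun x => x) contDiff_id (fun x _ => by rw [sub_self, norm_zero]; positivity), bumpIntegral]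
  simp only [det_fderiv_smul_sub differentiable_fun_id, fderiv_fun_id]
  have hc : Continuous fun x : Fin N → ℝ => euclideanBump ((r / 3)⁻¹ • (x - p)) *
      ((r / 3)⁻¹ ^ N * (ContinuousLinearMap.id ℝ (Fin N → ℝ)).det) :=
    ((euclideanBump_contDiff (k := 1)).continuous.comp (by fun_prop)).mul continuous_const
  rw [gt_iff_lt, setIntegral_pos_iff_support_of_nonneg_ae]
  · refine lt_of_lt_of_le ?_ (measure_mono (inter_subset_inter_right _ ball_subset_closedBall))
    refine (hc.isOpen_support.inter isOpen_ball).measure_pos _ ⟨p, ?_, mem_ball_self hr⟩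
    simp [euclideanBump, ContinuousLinearMap.det, hr.ne']
  · refine Eventually.of_forall fun x => ?_
    have := euclideanBump_nonneg ((r / 3)⁻¹ • (x - p))
    simp only [ContinuousLinearMap.det, ContinuousLinearMap.coe_id, LinearMap.det_id]
    positivity
  · exact hc.continuousOn.integrableOn_compact (isCompact_closedBall p r)
theorem integral_euclideanBump_pos : 0 < ∫ w : Fin N → ℝ, euclideanBump w := by
  have hc := (euclideanBump_contDiff (N := N) (k := 1)).continuous
  refine hc.integral_pos_of_hasCompactSupport_nonneg_nonzero ?_ euclideanBump_nonneg (x := 0)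
    (by simp [euclideanBump])
  refine HasCompactSupport.intro (isCompact_closedBall 0 1) fun x hx => euclideanBump_eq_zero ?_
  rw [mem_closedBall_zero_iff, not_le] at hx
  exact hx.le

/-- If the degree of `f` vanishes over the support of `g`, so does the integral of the pullback of
`g(y) dy` under `f`. -/
theorem integral_pullback_eq_zero {f : (Fin N → ℝ) → Fin N → ℝ} (hf : ContDiff ℝ 2 f)
    {g : (Fin N → ℝ) → ℝ} (hg : Continuous g) (hgs : HasCompactSupport g) (hε : 0 < ε)
    (H : ∀ y, g y ≠ 0 → ∀ η, 0 < η → η ≤ ε → bumpIntegral p r (fun x => η⁻¹ • (f x - y)) = 0) :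
    ∫ x in closedBall p r, g (f x) * (fderiv ℝ f x).det = 0 := by
  have hbc := (euclideanBump_contDiff (N := N) (k := 1)).continuous
  have hbs : HasCompactSupport (euclideanBump (N := N)) := by
    refine HasCompactSupport.intro (isCompact_closedBall 0 1) fun x hx => euclideanBump_eq_zero ?_
    rw [mem_closedBall_zero_iff, not_le] at hx
    exact hx.le
  have hbi : Integrable (euclideanBump (N := N)) := hbc.integrable_of_hasCompactSupport hbs
  set D : (Fin N → ℝ) → ℝ := fun x => (fderiv ℝ f x).det
  have hD : Continuous D :=
    ContinuousLinearMap.continuous_det.comp (hf.continuous_fderiv (by norm_num))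
  have hfc : Continuous f := hf.continuous
  set c := ∫ w : Fin N → ℝ, euclideanBump w
  have hc : 0 < c := integral_euclideanBump_pos
  -- the pullback of the mollified function has zero integral
  have hmoll : ∀ η, 0 < η → η ≤ ε →
      ∫ x in closedBall p r, D x * ∫ w, g (f x - η • w) * euclideanBump w = 0 := by
    intro η hη hηε
    have h1 : ∀ x, ∫ w, g (f x - η • w) * euclideanBump w
        = η⁻¹ ^ N * ∫ y, g y * euclideanBump (η⁻¹ • (f x - y)) := by
      intro x
      have e1 := integral_sub_left_eq_self (fun y => g y * euclideanBump (η⁻¹ • (f x - y))) volume (f x)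
      have e2 := Measure.integral_comp_smul volume
        (fun z => g (f x - z) * euclideanBump (η⁻¹ • z)) η
      simp only [sub_sub_cancel] at e1
      simp only [smul_smul, inv_mul_cancel₀ hη.ne', one_smul] at e2
      rw [e2, ← e1]
      simp [abs_of_pos hη]
    have h2 : ∀ y, g y * ∫ x in closedBall p r, euclideanBump (η⁻¹ • (f x - y)) * D x = 0 := by
      intro y
      by_cases hy : g y = 0
      · simp [hy]
      · have := H y hy η hη hηε
        rw [bumpIntegral] at this
        simp only [det_fderiv_smul_sub (hf.differentiable (by norm_num))] at this
        have h3 : ∀ x, euclideanBump (η⁻¹ • (f x - y)) * (η⁻¹ ^ N * (fderiv ℝ f x).det)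
            = η⁻¹ ^ N * (euclideanBump (η⁻¹ • (f x - y)) * D x) := fun x => by ring
        simp only [h3, integral_const_mul] at this
        rcases mul_eq_zero.1 this with h | h
        · exact absurd h (by positivity)
        · rw [h, mul_zero]
    -- By Fubini, integrate over `x` first; for fixed `y` that integral is zero by `h2`.
    have h3 : ∫ x in closedBall p r, ∫ y, D x * (g y * euclideanBump (η⁻¹ • (f x - y))) = 0 := by
      rw [integral_integral_swap]
      · rw [← integral_zero (Fin N → ℝ) ℝ (μ := volume)]
        congr 1
        funext y
        rw [← h2 y, ← integral_const_mul]
        congr 1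
        funext x
        ring
      · have hi : Integrable (fun z : (Fin N → ℝ) × (Fin N → ℝ) => D z.1 * g z.2)
            ((volume.restrict (closedBall p r)).prod volume) :=
          (hD.continuousOn.integrableOn_compact (isCompact_closedBall p r)).mul_prod
            (hg.integrable_of_hasCompactSupport hgs)
        have := hi.mul_bdd (c := 1) (g := fun z => euclideanBump (η⁻¹ • (f z.1 - z.2)))
          (Continuous.aestronglyMeasurable (by fun_prop)) (Eventually.of_forall fun z => by
            rw [Real.norm_of_nonneg (euclideanBump_nonneg _)]
            exact Real.smoothTransition.le_one _)
        refine this.congr (Eventually.of_forall fun z => ?_)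
        simp only [Function.uncurry]
        ring
    calc _ = ∫ x in closedBall p r,
        η⁻¹ ^ N * ∫ y, D x * (g y * euclideanBump (η⁻¹ • (f x - y))) := by
          congr 1
          funext x
          rw [h1, integral_const_mul]
          ring
      _ = 0 := by rw [integral_const_mul, h3, mul_zero]
  have hgu : UniformContinuous g := hgs.uniformContinuous_of_continuous hg
  set A := ∫ x in closedBall p r, |D x|
  -- As `η` shrinks, the mollifications tend uniformly to `c * g`; the factor `c` is there because
  -- the bump is not normalized. The integral sought is thus a limit of zeros.
  have hbound : ∀ δ > 0, |c * ∫ x in closedBall p r, g (f x) * D x| ≤ δ * (c * A) := by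
    intro δ hδ
    obtain ⟨τ, hτ, hgτ⟩ := Metric.uniformContinuous_iff.1 hgu δ hδ
    set η := min ε (τ / 2)
    have hη : 0 < η := lt_min hε (half_pos hτ)
    have hητ : η < τ := (min_le_right _ _).trans_lt (half_lt_self hτ)
    have hgint : ∀ x, Integrable fun w => g (f x - η • w) * euclideanBump w := fun x =>
      Continuous.integrable_of_hasCompactSupport (by fun_prop) hbs.mul_left
    have hpt : ∀ x, |c * g (f x) - ∫ w, g (f x - η • w) * euclideanBump w| ≤ δ * c := by
      intro x
      have : c * g (f x) - ∫ w, g (f x - η • w) * euclideanBump w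
          = ∫ w, (g (f x) - g (f x - η • w)) * euclideanBump w := by
        rw [mul_comm, ← integral_const_mul, ← integral_sub (hbi.const_mul _) (hgint x)]
        congr 1; funext w; ring
      rw [this, ← integral_const_mul, ← Real.norm_eq_abs]
      refine norm_integral_le_of_norm_le (hbi.const_mul δ) (Eventually.of_forall fun w => ?_)
      rw [norm_mul, Real.norm_of_nonneg (euclideanBump_nonneg w)]
      by_cases hw : 1 ≤ ‖w‖
      · simp [euclideanBump_eq_zero hw]
      · refine mul_le_mul_of_nonneg_right ?_ (euclideanBump_nonneg w)
        rw [← dist_eq_norm]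
        refine (hgτ ?_).le
        rw [dist_eq_norm, sub_sub_cancel, norm_smul, Real.norm_of_nonneg hη.le]
        nlinarith [norm_nonneg w]
    have hcont : Continuous fun x => ∫ w, g (f x - η • w) * euclideanBump w := by
      have hset : ∀ x, ∫ w, g (f x - η • w) * euclideanBump w
          = ∫ w in closedBall (0 : Fin N → ℝ) 1, g (f x - η • w) * euclideanBump w := by
        intro x
        refine (setIntegral_eq_integral_of_forall_compl_eq_zero fun w hw => ?_).symm
        rw [mem_closedBall_zero_iff, not_le] at hw
        rw [euclideanBump_eq_zero hw.le, mul_zero]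
      simp only [hset]
      exact continuous_parametric_integral_of_continuous (by fun_prop) (isCompact_closedBall _ _)
    have hi1 : IntegrableOn (fun x => c * (g (f x) * D x)) (closedBall p r) :=
      Continuous.continuousOn (by fun_prop) |>.integrableOn_compact (isCompact_closedBall p r)
    have hi2 : IntegrableOn (fun x => D x * ∫ w, g (f x - η • w) * euclideanBump w)
        (closedBall p r) :=
      Continuous.continuousOn (by fun_prop) |>.integrableOn_compact (isCompact_closedBall p r)
    have hi3 : IntegrableOn (fun x => |D x|) (closedBall p r) :=
      Continuous.continuousOn (by fun_prop) |>.integrableOn_compact (isCompact_closedBall p r)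
    have heq : c * ∫ x in closedBall p r, g (f x) * D x = ∫ x in closedBall p r,
        (c * g (f x) - ∫ w, g (f x - η • w) * euclideanBump w) * D x := by
      rw [← integral_const_mul, ← sub_zero (∫ x in closedBall p r, _), ← hmoll η hη (min_le_left _ _),
        ← integral_sub hi1 hi2]
      congr 1; funext x; ring
    rw [heq, ← mul_assoc, ← integral_const_mul, ← Real.norm_eq_abs]
    refine norm_integral_le_of_norm_le (hi3.const_mul _) (Eventually.of_forall fun x => ?_)
    rw [norm_mul, Real.norm_eq_abs, Real.norm_eq_abs]
    exact mul_le_mul_of_nonneg_right (hpt x) (abs_nonneg _)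
  have hA : 0 ≤ A := integral_nonneg fun x => abs_nonneg _
  have hz : |c * ∫ x in closedBall p r, g (f x) * D x| ≤ 0 := by
    refine le_of_forall_pos_le_add fun δ hδ => ?_
    have := hbound (δ / (c * A + 1)) (by positivity)
    refine this.trans ?_
    rw [zero_add, div_mul_eq_mul_div, div_le_iff₀ (by positivity)]
    nlinarith
  rcases mul_eq_zero.1 (abs_nonpos_iff.1 hz) with h | h
  · exact absurd h hc.ne'
  · exact h

end

/-! ### Injective maps have nonzero degree -/

section
variable {N : ℕ} {φ : (Fin N → ℝ) → Fin N → ℝ} {p y : Fin N → ℝ} {r ε d : ℝ}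

/-- A continuous injective map on a closed ball has a continuous left inverse defined everywhere. -/
theorem exists_continuous_leftInvOn (hφ : ContinuousOn φ (closedBall p r))
    (hinj : InjOn φ (closedBall p r)) :
    ∃ ψ : (Fin N → ℝ) → Fin N → ℝ, Continuous ψ ∧ LeftInvOn ψ φ (closedBall p r) := by
  have : CompactSpace (closedBall p r) := isCompact_iff_compactSpace.1 (isCompact_closedBall p r)
  have he : IsClosedEmbedding ((closedBall p r).domRestrict φ) :=
    hφ.domRestrict.isClosedEmbedding hinj.injective
  obtain ⟨g, hg⟩ := ContinuousMap.exists_extension' he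
    (⟨Subtype.val, continuous_subtype_val⟩ : C(closedBall p r, Fin N → ℝ))
  exact ⟨g, g.continuous, fun x hx => congrFun hg ⟨x, hx⟩⟩

/-- A point outside the image has degree zero anyway. Otherwise it is `φ x` with `x` in the open
ball, and by injectivity the degree over `φ a` is defined and locally constant for `a` in that
connected ball. -/
theorem HasDegree.zero_of_leftInvOn (hr : 0 < r) (hφ : ContinuousOn φ (closedBall p r))
    {ψ : (Fin N → ℝ) → Fin N → ℝ} (hψ : LeftInvOn ψ φ (closedBall p r))
    (h0 : HasDegree φ p r (φ p) 0) (hy : ‖ψ y - p‖ < r) : HasDegree φ p r y 0 := by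
  have hpb : p ∈ closedBall p r := mem_closedBall_self hr.le
  have hinj : InjOn φ (closedBall p r) := hψ.injOn
  by_cases hyi : ∀ x ∈ closedBall p r, φ x ≠ y
  · exact .of_notMem_image hφ hyi
  push Not at hyi
  obtain ⟨x, hx, rfl⟩ := hyi
  rw [hψ hx, ← dist_eq_norm] at hy
  have hconn : IsPreconnected (ball p r) := (convex_ball p r).isPreconnected
  refine (hconn.induction₂ (fun a b => HasDegree φ p r (φ a) 0 ↔ HasDegree φ p r (φ b) 0) ?_
    (fun a b c _ _ _ => Iff.trans) (fun a b _ _ => Iff.symm) (mem_ball_self hr) hy).1 h0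
  intro a ha
  have hab := ball_subset_closedBall ha
  obtain ⟨d, hd⟩ := HasDegree.exists (y := φ a) hr hφ fun z hz hza => by
    have := hinj (sphere_subset_closedBall hz) hab hza
    subst this
    exact (mem_ball.1 ha).ne (mem_sphere.1 hz)
  have hcont : Tendsto φ (𝓝[ball p r] a) (𝓝 (φ a)) :=
    (hφ a hab).mono_left (nhdsWithin_mono _ ball_subset_closedBall)
  filter_upwards [hcont.eventually hd.eventually] with b hb
  constructor
  · intro h; rwa [hd.unique hφ h] at hb
  · intro h; rwa [hb.unique hφ h] at hd

/-- Suppose the degree is zero and let `ψ` be a left inverse. With smooth approximations `f` of `φ`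
and `ψ'` of `ψ`, the map `ψ' ∘ f` is close to the identity, so its degree integral is positive. But
the bump form pulled back by `ψ'` is a density `g` supported where `ψ` is near `p`, and there the
degree of `φ` is zero, so pulling `g` back by `f` integrates to zero. -/
theorem HasDegree.ne_zero (hr : 0 < r) (hφ : ContinuousOn φ (closedBall p r))
    (hinj : InjOn φ (closedBall p r)) (h : HasDegree φ p r (φ p) d) : d ≠ 0 := by
  rintro rfl
  obtain ⟨ψ, hψc, hψ⟩ := exists_continuous_leftInvOn hφ hinj
  obtain ⟨R, hR⟩ : ∃ R, ∀ x ∈ closedBall p r, ‖φ x‖ ≤ R := by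
    obtain ⟨R, hR⟩ := (isCompact_closedBall p r).exists_bound_of_continuousOn hφ
    exact ⟨R, hR⟩
  obtain ⟨d₀, hd₀, hid⟩ := HasDegree.id_pos (p := p) hr
  -- the region that matters is uniformly far from the image of the sphere
  obtain ⟨ε₁, hε₁, hdist⟩ : ∃ ε > 0, ∀ x ∈ sphere p r, ∀ y, ‖y‖ ≤ R + 2 → ‖ψ y - p‖ ≤ r / 2 →
      3 * ε ≤ ‖φ x - y‖ := by
    have hcomp : IsCompact (sphere p r ×ˢ (closedBall (0 : Fin N → ℝ) (R + 2) ∩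
        {y | ‖ψ y - p‖ ≤ r / 2})) :=
      (isCompact_sphere p r).prod ((isCompact_closedBall _ _).inter_right
        (isClosed_le (by fun_prop) continuous_const))
    obtain ⟨ε, hε, H⟩ := hcomp.exists_pos_le_norm_sub (φ := fun z => φ z.1 - z.2) (y := 0)
      ((hφ.comp continuousOn_fst fun z hz => sphere_subset_closedBall hz.1).sub continuousOn_snd)
      (fun z hz hz0 => by
        have h1 : ‖ψ z.2 - p‖ ≤ r / 2 := hz.2.2
        rw [← sub_eq_zero.1 hz0, hψ (sphere_subset_closedBall hz.1), ← dist_eq_norm,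
          mem_sphere.1 hz.1] at h1
        linarith)
    refine ⟨ε / 3, by positivity, fun x hx y hy hy' => ?_⟩
    have := H (x, y) ⟨hx, by simpa using hy, hy'⟩
    simp only [sub_zero] at this
    linarith
  -- Two errors of size `δ` make up `r / 3`, the tolerance in `HasDegree.id_pos`; and a bump of
  -- width `r / 3` in `ψ'` lives where `ψ` is within `r / 3 + δ = r / 2` of `p`.
  set δ := r / 6
  have hδ : 0 < δ := by positivity
  have huc := (isCompact_closedBall (0 : Fin N → ℝ) (R + 1)).uniformContinuousOn_of_continuous
    hψc.continuousOn
  obtain ⟨τ, hτ, hψτ⟩ := Metric.uniformContinuousOn_iff.1 huc δ hδ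
  set ε := min ε₁ (min 1 (τ / 2))
  have hε : 0 < ε := lt_min hε₁ (lt_min one_pos (half_pos hτ))
  have hε1 : ε ≤ 1 := (min_le_right _ _).trans (min_le_left _ _)
  have hετ : ε < τ :=
    ((min_le_right _ _).trans (min_le_right _ _)).trans_lt (half_lt_self hτ)
  obtain ⟨f, hf, hfφ⟩ := exists_contDiff_approx_on_closedBall hφ hε
  obtain ⟨ψ', hψ', hψψ', -⟩ := hψc.exists_contDiff_approx 2 (continuous_const (y := δ))
    (fun _ => hδ)
  have hfR : ∀ x ∈ closedBall p r, ‖f x‖ ≤ R + 1 := fun x hx => by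
    have := norm_le_norm_add_norm_sub (φ x) (f x)
    rw [norm_sub_rev] at this
    linarith [hfφ x hx, hR x hx]
  have hu : ∀ x ∈ closedBall p r, ‖ψ' (f x) - x‖ ≤ r / 3 := by
    intro x hx
    have h1 : dist (ψ (f x)) (ψ (φ x)) < δ := by
      refine hψτ _ ?_ _ ?_ ?_
      · simpa using hfR x hx
      · simpa using (hR x hx).trans (by linarith)
      · rw [dist_eq_norm]; exact (hfφ x hx).trans_lt hετ
    rw [hψ hx] at h1
    have h2 := dist_triangle (ψ' (f x)) (ψ (f x)) x
    rw [← dist_eq_norm]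
    have h3 : δ = r / 6 := rfl
    linarith [hψψ' (f x)]
  have hpull := hid (r / 3) (by positivity) le_rfl (fun x => ψ' (f x))
    (hψ'.comp hf) hu
  -- A cutoff that makes `g` compactly supported without changing it on the image of `f`, which lies
  -- in the ball of radius `R + 1`.
  set χ : (Fin N → ℝ) → ℝ := fun y => max 0 (min 1 (R + 2 - ‖y‖))
  have hχc : Continuous χ := by fun_prop
  have hχ0 : ∀ y, R + 2 < ‖y‖ → χ y = 0 := fun y hy =>
    max_eq_left ((min_le_right _ _).trans (by linarith))
  have hχ1 : ∀ y, ‖y‖ ≤ R + 1 → χ y = 1 := fun y hy => by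
    simp only [χ]
    rw [min_eq_left (by linarith), max_eq_right zero_le_one]
  set η := r / 3
  have hη : 0 < η := by positivity
  set g : (Fin N → ℝ) → ℝ := fun y =>
    χ y * (euclideanBump (η⁻¹ • (ψ' y - p)) * (fderiv ℝ ψ' y).det)
  have hgc : Continuous g := by
    have h1 : Continuous fun y => (fderiv ℝ ψ' y).det :=
      ContinuousLinearMap.continuous_det.comp (hψ'.continuous_fderiv (by norm_num))
    have h2 := (euclideanBump_contDiff (N := N) (k := 1)).continuous
    have h3 : Continuous ψ' := hψ'.continuous
    fun_prop
  have hgs : HasCompactSupport g := by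
    refine HasCompactSupport.intro (isCompact_closedBall 0 (R + 2)) fun y hy => ?_
    rw [mem_closedBall_zero_iff, not_le] at hy
    simp [g, hχ0 y hy]
  have hzero := integral_pullback_eq_zero (p := p) (r := r) hf hgc hgs hε₁ (fun y hy η' hη' hη'ε => by
    have hyR : ‖y‖ ≤ R + 2 := by
      by_contra! hlt
      exact hy (by simp [g, hχ0 y hlt])
    have hyψ : ‖ψ y - p‖ ≤ r / 2 := by
      by_contra! hlt
      refine hy ?_
      have h1 : 1 ≤ ‖η⁻¹ • (ψ' y - p)‖ := by
        have h2 := dist_triangle (ψ y) (ψ' y) p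
        rw [dist_comm (ψ y) (ψ' y), dist_eq_norm (ψ y) p, dist_eq_norm (ψ' y) p] at h2
        rw [norm_smul, norm_inv, Real.norm_of_nonneg hη.le, inv_mul_eq_div, le_div_iff₀ hη]
        have := hψψ' y
        simp only [δ, η] at *
        linarith
      simp [g, euclideanBump_eq_zero h1]
    obtain ⟨d, hd⟩ := HasDegreeScale.exists (y := y) hr hφ hε₁ fun x hx => hdist x hx y hyR hyψ
    have hd0 : HasDegree φ p r y 0 := h.zero_of_leftInvOn hr hφ hψ (by linarith)
    rw [HasDegree.unique hφ ⟨ε₁, hε₁, hd⟩ hd0] at hd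
    exact hd η' hη' hη'ε f hf fun x hx => (hfφ x hx).trans (min_le_left _ _))
  have hfd : Differentiable ℝ f := hf.differentiable (by norm_num)
  have hψd : Differentiable ℝ ψ' := hψ'.differentiable (by norm_num)
  have hcomp : bumpIntegral p r (fun x => η⁻¹ • (ψ' (f x) - p))
      = η⁻¹ ^ N * ∫ x in closedBall p r, g (f x) * (fderiv ℝ f x).det := by
    rw [bumpIntegral, ← integral_const_mul]
    refine setIntegral_congr_fun isClosed_closedBall.measurableSet fun x hx => ?_
    simp only [det_fderiv_smul_sub (f := fun x => ψ' (f x)) (hψd.comp hfd), g, hχ1 _ (hfR x hx)]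
    have : fderiv ℝ (fun x => ψ' (f x)) x = (fderiv ℝ ψ' (f x)).comp (fderiv ℝ f x) :=
      fderiv_comp x (hψd _) (hfd _)
    rw [this]
    simp only [ContinuousLinearMap.det, ContinuousLinearMap.toLinearMap_comp, LinearMap.det_comp]
    ring
  rw [hcomp, hzero, mul_zero] at hpull
  exact hd₀.ne hpull

end

/-! ### Local degree and invariance of domain -/

/-- `d` is (a fixed multiple of) the local degree of `φ` at `p`. -/
def HasLocalDegree {N : ℕ} (φ : (Fin N → ℝ) → Fin N → ℝ) (p : Fin N → ℝ) (d : ℝ) : Prop :=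
  ∀ᶠ r in 𝓝[>] (0 : ℝ), HasDegree φ p r (φ p) d

section
variable {N : ℕ} {φ φ' : (Fin N → ℝ) → Fin N → ℝ} {p : Fin N → ℝ} {d d' : ℝ}
  {U : Set (Fin N → ℝ)}

theorem eventually_closedBall_subset_nhdsGT (hU : U ∈ 𝓝 p) :
    ∀ᶠ r in 𝓝[>] (0 : ℝ), closedBall p r ⊆ U := by
  obtain ⟨R, hR, h⟩ := nhds_basis_closedBall.mem_iff.1 hU
  filter_upwards [Ioc_mem_nhdsGT hR] with r hr
  exact (closedBall_subset_closedBall hr.2).trans h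

theorem HasDegree.congr {y : Fin N → ℝ} {r : ℝ} (h : HasDegree φ p r y d)
    (hφ : EqOn φ φ' (closedBall p r)) : HasDegree φ' p r y d := by
  obtain ⟨ε, hε, h⟩ := h
  exact ⟨ε, hε, fun η h0 hη f hf hfφ => h η h0 hη f hf fun x hx => by rw [hφ hx]; exact hfφ x hx⟩

theorem HasLocalDegree.congr (h : HasLocalDegree φ p d) (hφ : φ =ᶠ[𝓝 p] φ') :
    HasLocalDegree φ' p d := by
  filter_upwards [h, eventually_closedBall_subset_nhdsGT hφ] with r hr hsub
  rw [← hφ.self_of_nhds]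
  exact hr.congr hsub

/-- By injectivity `q` is the only preimage of `φ q`, so excision shrinks the ball to any small one
around `q`. -/
theorem HasDegree.hasLocalDegree {R : ℝ} {q : Fin N → ℝ} (hφ : ContinuousOn φ (closedBall p R))
    (hinj : InjOn φ (closedBall p R)) (hq : q ∈ ball p R) (h : HasDegree φ p R (φ q) d) :
    HasLocalDegree φ q d := by
  filter_upwards [eventually_closedBall_subset_nhdsGT (isOpen_ball.mem_nhds hq),
    self_mem_nhdsWithin] with r hr hr0
  have hqb := ball_subset_closedBall hq
  refine h.restrict hφ hr0 (hr.trans ball_subset_closedBall) fun x hx hxr hxq => hxr ?_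
  rw [hinj hx hqb hxq]
  exact mem_ball_self hr0

theorem HasLocalDegree.exists (hφ : ContinuousOn φ U) (hinj : InjOn φ U) (hU : U ∈ 𝓝 p) :
    ∃ d, d ≠ 0 ∧ ∀ᶠ q in 𝓝 p, HasLocalDegree φ q d := by
  obtain ⟨R, hR, h⟩ := nhds_basis_closedBall.mem_iff.1 hU
  obtain ⟨d, hd⟩ := HasDegree.exists (y := φ p) hR (hφ.mono h) fun x hx hxp => by
    have := hinj (h (sphere_subset_closedBall hx)) (h (mem_closedBall_self hR.le)) hxp
    rw [this, mem_sphere, dist_self] at hx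
    exact hR.ne hx
  refine ⟨d, hd.ne_zero hR (hφ.mono h) (hinj.mono h), ?_⟩
  have hc : ContinuousAt φ p := hφ.continuousAt hU
  filter_upwards [hc.eventually hd.eventually, ball_mem_nhds p hR] with q hq hqb
  exact hq.hasLocalDegree (hφ.mono h) (hinj.mono h) hqb

theorem HasLocalDegree.unique (hφ : ContinuousOn φ U) (hU : U ∈ 𝓝 p)
    (h : HasLocalDegree φ p d) (h' : HasLocalDegree φ p d') : d = d' := by
  obtain ⟨r, hr, hr', hs⟩ := (h.and (h'.and (eventually_closedBall_subset_nhdsGT hU))).exists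
  exact hr.unique (hφ.mono hs) hr'

theorem HasLocalDegree.of_isPreconnected (hφ : ContinuousOn φ U) (hinj : InjOn φ U)
    (hU : IsOpen U) (hconn : IsPreconnected U) (hp : p ∈ U) {q : Fin N → ℝ} (hq : q ∈ U)
    (h : HasLocalDegree φ p d) : HasLocalDegree φ q d := by
  refine (hconn.induction₂ (fun a b => HasLocalDegree φ a d ↔ HasLocalDegree φ b d) ?_
    (fun a b c _ _ _ => Iff.trans) (fun a b _ _ => Iff.symm) hp hq).1 h
  intro a ha
  obtain ⟨e, -, he⟩ := HasLocalDegree.exists hφ hinj (hU.mem_nhds ha)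
  filter_upwards [nhdsWithin_le_nhds he, self_mem_nhdsWithin] with b hb hbU
  constructor
  · intro h; rwa [he.self_of_nhds.unique hφ (hU.mem_nhds ha) h] at hb
  · intro h
    have := he.self_of_nhds
    rwa [hb.unique hφ (hU.mem_nhds hbU) h] at this

/-- **Invariance of domain**, local form. -/
theorem image_mem_nhds_of_injOn (hφ : ContinuousOn φ U) (hinj : InjOn φ U) (hU : U ∈ 𝓝 p) :
    φ '' U ∈ 𝓝 (φ p) := by
  obtain ⟨R, hR, h⟩ := nhds_basis_closedBall.mem_iff.1 hU
  obtain ⟨d, hd⟩ := HasDegree.exists (y := φ p) hR (hφ.mono h) fun x hx hxp => by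
    have := hinj (h (sphere_subset_closedBall hx)) (h (mem_closedBall_self hR.le)) hxp
    rw [this, mem_sphere, dist_self] at hx
    exact hR.ne hx
  have hd0 := hd.ne_zero hR (hφ.mono h) (hinj.mono h)
  -- A nearby value omitted by `φ` would have degree zero, whereas the degree there is still `d`.
  filter_upwards [hd.eventually] with y hy
  by_contra hyU
  exact hd0 (hy.unique (hφ.mono h)
    (.of_notMem_image (hφ.mono h) fun x hx hxy => hyU ⟨x, h hx, hxy⟩))

/-! ### Signed permutations of the coordinates -/

/-- A linear map of `ℝ^N` that permutes the coordinates and changes their signs. -/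
structure IsSignedPerm (A : (Fin N → ℝ) ≃L[ℝ] (Fin N → ℝ)) : Prop where
  norm_map : ∀ x, ‖A x‖ = ‖x‖
  bump_map : ∀ x, euclideanBump (A x) = euclideanBump x
  abs_det : |(A : (Fin N → ℝ) →L[ℝ] (Fin N → ℝ)).det| = 1

/-- Approximations of `A ∘ φ` are `A` applied to approximations of `φ`, with the same error; the
bump does not see `A`, and the chain rule contributes `det A`. -/
theorem HasDegree.comp_left {A : (Fin N → ℝ) ≃L[ℝ] (Fin N → ℝ)} (hA : IsSignedPerm A) {r : ℝ}
    {y : Fin N → ℝ} (h : HasDegree φ p r y d) :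
    HasDegree (fun x => A (φ x)) p r (A y)
      ((A : (Fin N → ℝ) →L[ℝ] (Fin N → ℝ)).det * d) := by
  obtain ⟨ε, hε, h⟩ := h
  refine ⟨ε, hε, fun η h0 hη f hf hfφ => ?_⟩
  have hg : ContDiff ℝ 2 fun x => A.symm (f x) := A.symm.contDiff.comp hf
  rw [← h η h0 hη (fun x => A.symm (f x)) hg fun x hx => ?_]
  · simp only [bumpIntegral]
    rw [← integral_const_mul]
    congr 1
    funext x
    have h1 : (fun x => η⁻¹ • (f x - A y)) = fun x => A (η⁻¹ • (A.symm (f x) - y)) := by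
      funext x; simp
    have h2 : DifferentiableAt ℝ (fun x => η⁻¹ • (A.symm (f x) - y)) x :=
      ((hg.differentiable (by norm_num) x).sub_const _).fun_const_smul _
    have h3 : fderiv ℝ (fun x => A (η⁻¹ • (A.symm (f x) - y))) x
        = (A : (Fin N → ℝ) →L[ℝ] (Fin N → ℝ)).comp (fderiv ℝ (fun x => η⁻¹ • (A.symm (f x) - y)) x) :=
      A.toContinuousLinearMap.hasFDerivAt.comp x h2.hasFDerivAt |>.fderiv
    rw [congrFun h1 x, h1, h3, hA.bump_map]
    simp only [ContinuousLinearMap.det, ContinuousLinearMap.toLinearMap_comp, LinearMap.det_comp]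
    ring
  · rw [← hA.norm_map, map_sub, A.apply_symm_apply]
    exact hfφ x hx

/-- The chain rule contributes `det A`, while the change of variables contributes only `|det A| =
1`. -/
theorem HasDegree.comp_right {A : (Fin N → ℝ) ≃L[ℝ] (Fin N → ℝ)} (hA : IsSignedPerm A) {r : ℝ}
    {y : Fin N → ℝ} (h : HasDegree φ (A p) r y d) :
    HasDegree (fun x => φ (A x)) p r y
      ((A : (Fin N → ℝ) →L[ℝ] (Fin N → ℝ)).det * d) := by
  obtain ⟨ε, hε, h⟩ := h
  refine ⟨ε, hε, fun η h0 hη f hf hfφ => ?_⟩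
  have hball : ∀ x, x ∈ closedBall (A p) r ↔ A.symm x ∈ closedBall p r := fun x => by
    rw [mem_closedBall_iff_norm, mem_closedBall_iff_norm, ← hA.norm_map (A.symm x - p), map_sub,
      A.apply_symm_apply]
  have hg : ContDiff ℝ 2 fun x => f (A.symm x) := hf.comp A.symm.contDiff
  rw [← h η h0 hη (fun x => f (A.symm x)) hg fun x hx => ?_]
  · simp only [bumpIntegral]
    have himg : closedBall (A p) r = A '' closedBall p r := by
      ext x
      rw [hball]
      constructor
      · intro hx; exact ⟨_, hx, A.apply_symm_apply x⟩
      · rintro ⟨z, hz, rfl⟩; rwa [A.symm_apply_apply]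
    rw [himg, integral_image_eq_integral_abs_det_fderiv_smul volume
      isClosed_closedBall.measurableSet (fun x _ => A.hasFDerivAt.hasFDerivWithinAt)
      A.injective.injOn, hA.abs_det, ← integral_const_mul]
    congr 1
    funext x
    have h2 : DifferentiableAt ℝ (fun x => η⁻¹ • (f (A.symm x) - y)) (A x) :=
      ((hg.differentiable (by norm_num) _).sub_const _).fun_const_smul _
    have h1 : (fun x => η⁻¹ • (f x - y)) = fun x => (fun x => η⁻¹ • (f (A.symm x) - y)) (A x) := by
      funext x; simp
    have h3 : fderiv ℝ (fun x => (fun x => η⁻¹ • (f (A.symm x) - y)) (A x)) x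
        = (fderiv ℝ (fun x => η⁻¹ • (f (A.symm x) - y)) (A x)).comp
          (A : (Fin N → ℝ) →L[ℝ] (Fin N → ℝ)) :=
      h2.hasFDerivAt.comp x A.toContinuousLinearMap.hasFDerivAt |>.fderiv
    rw [h1, h3]
    simp only [ContinuousLinearMap.det, ContinuousLinearMap.toLinearMap_comp, LinearMap.det_comp]
    simp
    ring
  · have := hfφ _ ((hball x).1 hx)
    simpa only [A.apply_symm_apply] using this

theorem HasLocalDegree.comp_left {A : (Fin N → ℝ) ≃L[ℝ] (Fin N → ℝ)} (hA : IsSignedPerm A)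
    (h : HasLocalDegree φ p d) :
    HasLocalDegree (fun x => A (φ x)) p ((A : (Fin N → ℝ) →L[ℝ] (Fin N → ℝ)).det * d) :=
  Eventually.mono h fun _ hr => hr.comp_left hA

theorem HasLocalDegree.comp_right {A : (Fin N → ℝ) ≃L[ℝ] (Fin N → ℝ)} (hA : IsSignedPerm A)
    (h : HasLocalDegree φ (A p) d) :
    HasLocalDegree (fun x => φ (A x)) p ((A : (Fin N → ℝ) →L[ℝ] (Fin N → ℝ)).det * d) :=
  Eventually.mono h fun _ hr => hr.comp_right hA

/-- The permutation of the coordinates of `ℝ^N` by `σ`. -/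
noncomputable def coordPerm (σ : Equiv.Perm (Fin N)) : (Fin N → ℝ) ≃L[ℝ] (Fin N → ℝ) :=
  (LinearEquiv.funCongrLeft ℝ ℝ σ).toContinuousLinearEquiv

theorem coordPerm_apply (σ : Equiv.Perm (Fin N)) (x : Fin N → ℝ) (i : Fin N) :
    coordPerm σ x i = x (σ i) := rfl

theorem det_coordPerm (σ : Equiv.Perm (Fin N)) :
    (coordPerm σ : (Fin N → ℝ) →L[ℝ] (Fin N → ℝ)).det = (Equiv.Perm.sign σ : ℤ) := by
  rw [← Matrix.det_permutation, ContinuousLinearMap.det, ← LinearMap.det_toMatrix']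
  congr 1
  ext i j
  simp [LinearMap.toMatrix'_apply, coordPerm_apply, Equiv.toPEquiv, Pi.single_apply]

theorem isSignedPerm_coordPerm (σ : Equiv.Perm (Fin N)) : IsSignedPerm (coordPerm σ) where
  norm_map x := by
    refine le_antisymm ?_ ?_
    · exact (pi_norm_le_iff_of_nonneg (norm_nonneg _)).2 fun i => norm_le_pi_norm x (σ i)
    · refine (pi_norm_le_iff_of_nonneg (norm_nonneg _)).2 fun i => ?_
      simpa [coordPerm_apply] using norm_le_pi_norm (coordPerm σ x) (σ.symm i)
  bump_map x := by
    simp only [euclideanBump, coordPerm_apply]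
    rw [Equiv.sum_comp σ (fun i => x i ^ 2)]
  abs_det := by
    rw [det_coordPerm]
    rcases Int.units_eq_one_or (Equiv.Perm.sign σ) with h | h <;> simp [h]

/-- The reflection of `ℝ^(N+1)` that changes the sign of the first coordinate. -/
noncomputable def firstReflection (N : ℕ) : (Fin (N + 1) → ℝ) ≃L[ℝ] (Fin (N + 1) → ℝ) :=
  (LinearEquiv.piCongrRight fun i : Fin (N + 1) =>
    if i = 0 then LinearEquiv.neg ℝ else LinearEquiv.refl ℝ ℝ).toContinuousLinearEquiv

theorem firstReflection_apply_zero (x : Fin (N + 1) → ℝ) : firstReflection N x 0 = -x 0 := by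
  simp [firstReflection]

theorem firstReflection_apply_succ (x : Fin (N + 1) → ℝ) (i : Fin N) :
    firstReflection N x i.succ = x i.succ := by
  simp [firstReflection, Fin.succ_ne_zero]

theorem det_firstReflection :
    (firstReflection N : (Fin (N + 1) → ℝ) →L[ℝ] (Fin (N + 1) → ℝ)).det = -1 := by
  rw [ContinuousLinearMap.det, ← LinearMap.det_toMatrix']
  have : LinearMap.toMatrix' (firstReflection N : (Fin (N + 1) → ℝ) →L[ℝ] (Fin (N + 1) → ℝ)).toLinearMap
      = Matrix.diagonal (Fin.cons (-1) fun _ => 1) := by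
    ext i j
    rw [LinearMap.toMatrix'_apply, Matrix.diagonal_apply]
    change firstReflection N (Pi.single j 1) i = _
    refine Fin.cases ?_ (fun k => ?_) i
    · rw [firstReflection_apply_zero]
      rcases eq_or_ne 0 j with rfl | h <;> simp [*]
    · rw [firstReflection_apply_succ]
      rcases eq_or_ne k.succ j with rfl | h <;> simp [*]
  rw [this, Matrix.det_diagonal, Fin.prod_univ_succ]
  simp

theorem isSignedPerm_firstReflection : IsSignedPerm (firstReflection N) where
  norm_map x := by
    have h : ∀ i, ‖firstReflection N x i‖ = ‖x i‖ := by
      intro i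
      refine Fin.cases ?_ (fun j => ?_) i
      · rw [firstReflection_apply_zero, norm_neg]
      · rw [firstReflection_apply_succ]
    simp only [Pi.norm_def]
    congr 2
    funext i
    exact NNReal.eq (h i)
  bump_map x := by
    simp only [euclideanBump, Fin.sum_univ_succ, firstReflection_apply_zero,
      firstReflection_apply_succ, neg_sq]
  abs_det := by rw [det_firstReflection, abs_neg, abs_one]

end

/-! ### The sign of the local degree -/

open scoped Classical in
/-- The sign of the local degree. -/
noncomputable def localSign {N : ℕ} (φ : (Fin N → ℝ) → Fin N → ℝ) (p : Fin N → ℝ) : ℤˣ :=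
  if ∃ d > 0, HasLocalDegree φ p d then 1 else -1

section
variable {N : ℕ} {φ φ' : (Fin N → ℝ) → Fin N → ℝ} {p : Fin N → ℝ} {d : ℝ}
  {U : Set (Fin N → ℝ)}

theorem localSign_of_pos (h : HasLocalDegree φ p d) (hd : 0 < d) : localSign φ p = 1 :=
  if_pos ⟨d, hd, h⟩

theorem localSign_of_neg (hφ : ContinuousOn φ U) (hU : U ∈ 𝓝 p) (h : HasLocalDegree φ p d)
    (hd : d < 0) : localSign φ p = -1 := by
  refine if_neg ?_
  rintro ⟨e, he, h'⟩
  rw [h'.unique hφ hU h] at he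
  exact lt_asymm he hd

theorem localSign_congr (hφ : φ =ᶠ[𝓝 p] φ') : localSign φ p = localSign φ' p := by
  have : ∀ d, HasLocalDegree φ p d ↔ HasLocalDegree φ' p d := fun d =>
    ⟨fun h => h.congr hφ, fun h => h.congr hφ.symm⟩
  unfold localSign
  congr 1
  simp only [this]

theorem localSign_eq_of_isPreconnected (hφ : ContinuousOn φ U) (hinj : InjOn φ U)
    (hU : IsOpen U) (hconn : IsPreconnected U) (hp : p ∈ U) {q : Fin N → ℝ} (hq : q ∈ U) :
    localSign φ p = localSign φ q := by
  have : ∀ d, HasLocalDegree φ p d ↔ HasLocalDegree φ q d := fun d =>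
    ⟨fun h => h.of_isPreconnected hφ hinj hU hconn hp hq,
      fun h => h.of_isPreconnected hφ hinj hU hconn hq hp⟩
  unfold localSign
  congr 1
  simp only [this]

/-- The local degree of an injective map exists and is nonzero, so a rule that multiplies degrees by
`s` multiplies signs by `s`. -/
theorem localSign_eq_mul (hφ : ContinuousOn φ U) (hinj : InjOn φ U) (hU : U ∈ 𝓝 p)
    {q : Fin N → ℝ} {V : Set (Fin N → ℝ)} (hφ' : ContinuousOn φ' V) (hV : V ∈ 𝓝 q) (s : ℤˣ)
    (h : ∀ d, HasLocalDegree φ p d → HasLocalDegree φ' q (((s : ℤ) : ℝ) * d)) :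
    localSign φ' q = s * localSign φ p := by
  obtain ⟨d, hd0, hd⟩ := HasLocalDegree.exists hφ hinj hU
  have hd := hd.self_of_nhds
  have hd' := h d hd
  rcases lt_or_gt_of_ne hd0 with hneg | hpos
  · rw [localSign_of_neg hφ hU hd hneg]
    rcases Int.units_eq_one_or s with rfl | rfl
    · rw [localSign_of_neg hφ' hV hd' (by simpa using hneg), one_mul]
    · rw [localSign_of_pos hd' (by simpa using hneg)]; simp
  · rw [localSign_of_pos hd hpos]
    rcases Int.units_eq_one_or s with rfl | rfl
    · rw [localSign_of_pos hd' (by simpa using hpos), one_mul]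
    · rw [localSign_of_neg hφ' hV hd' (by simpa using hpos), mul_one]

theorem localSign_firstReflection_comp {φ : (Fin (N + 1) → ℝ) → Fin (N + 1) → ℝ}
    {p : Fin (N + 1) → ℝ} {U : Set (Fin (N + 1) → ℝ)} (hφ : ContinuousOn φ U) (hinj : InjOn φ U)
    (hU : U ∈ 𝓝 p) : localSign (fun x => firstReflection N (φ x)) p = -localSign φ p := by
  rw [localSign_eq_mul (φ' := fun x => firstReflection N (φ x)) hφ hinj hU ((firstReflection N).continuous.comp_continuousOn hφ) hU (-1)]
  · simp
  · intro d hd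
    have := hd.comp_left isSignedPerm_firstReflection
    rw [det_firstReflection] at this
    simpa using this

theorem localSign_comp_firstReflection {φ : (Fin (N + 1) → ℝ) → Fin (N + 1) → ℝ}
    {p : Fin (N + 1) → ℝ} {U : Set (Fin (N + 1) → ℝ)} (hφ : ContinuousOn φ U) (hinj : InjOn φ U)
    (hU : U ∈ 𝓝 (firstReflection N p)) :
    localSign (fun x => φ (firstReflection N x)) p = -localSign φ (firstReflection N p) := by
  rw [localSign_eq_mul (φ' := fun x => φ (firstReflection N x)) hφ hinj hU (hφ.comp (firstReflection N).continuous.continuousOn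
    (mapsTo_preimage _ _)) ((firstReflection N).continuous.continuousAt hU) (-1)]
  · simp
  · intro d hd
    have := hd.comp_right isSignedPerm_firstReflection
    rw [det_firstReflection] at this
    simpa using this

theorem localSign_comp_coordPerm (hφ : ContinuousOn φ U) (hinj : InjOn φ U)
    (σ : Equiv.Perm (Fin N)) (hU : U ∈ 𝓝 (coordPerm σ p)) :
    localSign (fun x => φ (coordPerm σ x)) p
      = Equiv.Perm.sign σ * localSign φ (coordPerm σ p) := by
  refine localSign_eq_mul hφ hinj hU (hφ.comp (coordPerm σ).continuous.continuousOn
    (mapsTo_preimage _ _)) ((coordPerm σ).continuous.continuousAt hU) _ fun d hd => ?_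
  have := hd.comp_right (isSignedPerm_coordPerm σ)
  rwa [det_coordPerm] at this

/-! ### Invariance of domain and of dimension in normed spaces -/

/-- **Invariance of domain** in normed spaces of the same finite dimension. -/
theorem image_mem_nhds_of_injOn_of_equiv {E F : Type*} [NormedAddCommGroup E] [NormedSpace ℝ E]
    [NormedAddCommGroup F] [NormedSpace ℝ F] (e : E ≃L[ℝ] (Fin N → ℝ)) (e' : F ≃L[ℝ] (Fin N → ℝ))
    {φ : E → F} {U : Set E} {p : E} (hφ : ContinuousOn φ U) (hinj : InjOn φ U) (hU : U ∈ 𝓝 p) :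
    φ '' U ∈ 𝓝 (φ p) := by
  have h := image_mem_nhds_of_injOn (φ := fun x => e' (φ (e.symm x))) (U := e.symm ⁻¹' U)
    (p := e p)
    (e'.continuous.comp_continuousOn (hφ.comp e.symm.continuous.continuousOn (mapsTo_preimage _ _)))
    (fun x hx y hy hxy => e.symm.injective (hinj hx hy (e'.injective hxy)))
    (e.symm.continuous.continuousAt (by simpa using hU))
  simp only [e.symm_apply_apply] at h
  have h2 := e'.continuous.continuousAt (x := φ p) h
  refine mem_of_superset h2 ?_
  rintro y ⟨x, hx, hxy⟩
  exact ⟨e.symm x, hx, e'.injective hxy⟩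

/-- Invariance of dimension: a nonempty open subset of an `N`-dimensional space does not embed in
a space of smaller dimension. -/
theorem le_card_of_injOn {E : Type*} [NormedAddCommGroup E] [NormedSpace ℝ E]
    (e : E ≃L[ℝ] (Fin N → ℝ)) {ι : Type*} [Fintype ι] {φ : E → ι → ℝ} {U : Set E}
    (hU : IsOpen U) (hne : U.Nonempty) (hφ : ContinuousOn φ U) (hinj : InjOn φ U) :
    N ≤ Fintype.card ι := by
  by_contra! hlt
  obtain ⟨p, hp⟩ := hne
  obtain ⟨j⟩ := Function.Embedding.nonempty_of_card_le (α := ι) (β := Fin N) (by simpa using hlt.le)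
  obtain ⟨k, hk⟩ : ∃ k, k ∉ range j := by
    by_contra! h
    have := Fintype.card_le_of_surjective j h
    simp at this
    omega
  -- Extension by zero along `j` puts the image into the hyperplane where the coordinate `k`
  -- vanishes; by invariance of domain the image would contain a ball.
  have hc : Continuous fun x : ι → ℝ => Function.extend j x (0 : Fin N → ℝ) := by
    refine continuous_pi fun i => ?_
    by_cases hi : ∃ a, j a = i
    · obtain ⟨a, rfl⟩ := hi
      simp only [j.injective.extend_apply]
      fun_prop
    · simp only [Function.extend_apply' _ _ _ hi]
      fun_prop
  have hin : Function.Injective fun x : ι → ℝ => Function.extend j x (0 : Fin N → ℝ) := by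
    intro x y hxy
    funext a
    simpa only [j.injective.extend_apply] using congrFun hxy (j a)
  have h := image_mem_nhds_of_injOn_of_equiv e (.refl ℝ _)
    (φ := fun x => Function.extend j (φ x) (0 : Fin N → ℝ))
    (hc.comp_continuousOn hφ) (hin.comp_injOn hinj) (hU.mem_nhds hp)
  have hk0 : ∀ x : ι → ℝ, Function.extend j x (0 : Fin N → ℝ) k = 0 := fun x =>
    Function.extend_apply' _ _ _ (by simpa using hk)
  obtain ⟨ε, hε, hball⟩ := Metric.mem_nhds_iff.1 h
  set y := Function.extend j (φ p) (0 : Fin N → ℝ)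
  have hy : y + Pi.single k (ε / 2) ∈ ball y ε := by
    rw [mem_ball_iff_norm, add_sub_cancel_left, Pi.norm_single, Real.norm_eq_abs,
      abs_of_pos (by positivity)]
    linarith
  obtain ⟨x, -, hx⟩ := hball hy
  have := congrFun hx k
  simp only [hk0, Pi.add_apply, Pi.single_eq_same, y] at this
  linarith

end

/-! ### Orienting a triangulated sphere by local degrees of cones -/

section
variable {W : Type*} [Fintype W] {S : AbstractSimplicialComplex W}

theorem AbstractSimplicialComplex.mem_faces_of_subset {W : Type*} {S : AbstractSimplicialComplex W}
    {s t : Finset W} (hs : s ∈ S.faces) (hts : t ⊆ s) (ht : t.Nonempty) : t ∈ S.faces :=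
  (S.isRelLowerSet_faces hs).2 hts ht

/-- The weights on the vertices of `S` whose normalizations are points of the realization. -/
def realizationCone (S : AbstractSimplicialComplex W) : Set (W → ℝ) :=
  {x | (∀ w, 0 ≤ x w) ∧ 0 < ∑ w, x w ∧ ∃ s ∈ S.faces, ∀ w, w ∉ s → x w = 0}

theorem normalize_mem_realization {x : W → ℝ} (hx : x ∈ realizationCone S) :
    (∑ w, x w)⁻¹ • x ∈ realization S := by
  obtain ⟨h0, hpos, s, hs, hxs⟩ := hx
  refine ⟨⟨fun w => ?_, ?_⟩, s, hs, fun w hw => ?_⟩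
  · have := h0 w
    simp only [Pi.smul_apply, smul_eq_mul]
    positivity
  · simp only [Pi.smul_apply, smul_eq_mul, ← Finset.mul_sum]
    exact inv_mul_cancel₀ hpos.ne'
  · simp [hxs w hw]

variable {N : ℕ} {E : Type*} [NormedAddCommGroup E] [NormedSpace ℝ E]

/-- The radial extension of a map from the realization to the unit sphere of `E ≃ ℝ^N`, composed
with a parametrization `q` of weights. -/
noncomputable def radialExtension (e : E ≃L[ℝ] (Fin N → ℝ)) (Ψ : (W → ℝ) → E)
    (q : (Fin N → ℝ) → W → ℝ) (x : Fin N → ℝ) : Fin N → ℝ :=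
  (∑ w, q x w) • e (Ψ ((∑ w, q x w)⁻¹ • q x))

section
variable (e : E ≃L[ℝ] (Fin N → ℝ)) {Ψ : (W → ℝ) → E} {q : (Fin N → ℝ) → W → ℝ}
  {U : Set (Fin N → ℝ)}

theorem radialExtension_continuousOn (hΨ : ContinuousOn Ψ (realization S)) (hq : ContinuousOn q U)
    (hqU : MapsTo q U (realizationCone S)) : ContinuousOn (radialExtension e Ψ q) U := by
  have hm : ContinuousOn (fun x => ∑ w, q x w) U :=
    continuousOn_finsetSum _ fun w _ => (continuous_apply w).comp_continuousOn hq
  refine hm.smul (e.continuous.comp_continuousOn (hΨ.comp ?_ fun x hx =>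
    normalize_mem_realization (hqU hx)))
  exact (hm.inv₀ fun x hx => (hqU hx).2.1.ne').smul hq

/-- The norm of the value recovers the total weight, since `Ψ` lands in the unit sphere; injectivity
of `Ψ` then recovers the normalized weights. -/
theorem radialExtension_injOn (hinj : InjOn Ψ (realization S))
    (hnorm : ∀ x ∈ realization S, ‖Ψ x‖ = 1) (hq : InjOn q U)
    (hqU : MapsTo q U (realizationCone S)) : InjOn (radialExtension e Ψ q) U := by
  intro x hx y hy hxy
  have hx' := hqU hx
  have hy' := hqU hy
  simp only [radialExtension, ← map_smul] at hxy
  have hxy := e.injective hxy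
  have hm : ∑ w, q x w = ∑ w, q y w := by
    have := congrArg norm hxy
    rwa [norm_smul, norm_smul, hnorm _ (normalize_mem_realization hx'),
      hnorm _ (normalize_mem_realization hy'), mul_one, mul_one, Real.norm_of_nonneg hx'.2.1.le,
      Real.norm_of_nonneg hy'.2.1.le] at this
  refine hq hx hy ?_
  rw [← hm] at hxy
  have h2 := hinj (normalize_mem_realization hx') (hm ▸ normalize_mem_realization hy')
    (smul_right_injective _ hx'.2.1.ne' hxy)
  exact smul_right_injective _ (inv_ne_zero hx'.2.1.ne') h2

end

section
variable [DecidableEq W]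

/-- The weights with coordinates `x` at the vertices `t`. -/
noncomputable def simplexWeights {N : ℕ} (t : Fin N → W) (x : Fin N → ℝ) : W → ℝ :=
  ∑ i, x i • Pi.single (t i) (1 : ℝ)

theorem simplexWeights_apply {W : Type*} [DecidableEq W] {t : Fin N → W} (ht : Function.Injective t) (x : Fin N → ℝ)
    (i : Fin N) : simplexWeights t x (t i) = x i := by
  simp [simplexWeights, Finset.sum_apply, Pi.single_apply, ht.eq_iff]

theorem simplexWeights_apply_of_notMem {W : Type*} [DecidableEq W] {t : Fin N → W} (x : Fin N → ℝ)
    {w : W} (hw : w ∉ range t) : simplexWeights t x w = 0 := by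
  have : ∀ i, w ≠ t i := fun i h => hw ⟨i, h.symm⟩
  simp [simplexWeights, Finset.sum_apply, this]

theorem continuous_simplexWeights {W : Type*} [DecidableEq W] (t : Fin N → W) : Continuous (simplexWeights t) := by
  unfold simplexWeights
  fun_prop

theorem sum_simplexWeights (t : Fin N → W) (x : Fin N → ℝ) :
    ∑ w, simplexWeights t x w = ∑ i, x i := by
  simp only [simplexWeights, Finset.sum_apply, Pi.smul_apply, smul_eq_mul]
  rw [Finset.sum_comm]
  simp [← Finset.mul_sum]

/-- The open positive orthant. -/
def positiveOrthant (N : ℕ) : Set (Fin N → ℝ) := {x | ∀ i, 0 < x i}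

theorem isOpen_positiveOrthant : IsOpen (positiveOrthant N) := by
  simp only [positiveOrthant, ofPred_forall]
  exact isOpen_iInter_of_finite fun i => isOpen_lt continuous_const (continuous_apply i)

theorem positiveOrthant_mem_nhds_one : positiveOrthant N ∈ 𝓝 (1 : Fin N → ℝ) :=
  isOpen_positiveOrthant.mem_nhds fun _ => one_pos

theorem simplexWeights_mem_cone {n : ℕ} {t : Fin (n + 1) → W} (ht : IsOrderedSimplex S t) :
    MapsTo (simplexWeights t) (positiveOrthant (n + 1)) (realizationCone S) := by
  obtain ⟨hinj, s, hs, hst⟩ := ht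
  intro x hx
  refine ⟨fun w => ?_, ?_, s, hs, fun w hw => simplexWeights_apply_of_notMem x ?_⟩
  · by_cases hw : w ∈ range t
    · obtain ⟨i, rfl⟩ := hw
      rw [simplexWeights_apply hinj]
      exact (hx i).le
    · rw [simplexWeights_apply_of_notMem x hw]
  · rw [sum_simplexWeights]
    exact Finset.sum_pos (fun i _ => hx i) Finset.univ_nonempty
  · rwa [← hst]

theorem simplexWeights_injective {W : Type*} [DecidableEq W] {t : Fin N → W} (ht : Function.Injective t) :
    Function.Injective (simplexWeights t) := by
  intro x y hxy
  funext i
  rw [← simplexWeights_apply ht x, hxy, simplexWeights_apply ht]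

/-- The sign of an ordered simplex of a complex mapped to a sphere: the local degree of the cone
over the map. -/
noncomputable def simplexSign (e : E ≃L[ℝ] (Fin N → ℝ)) (Ψ : (W → ℝ) → E) (t : Fin N → W) : ℤˣ :=
  localSign (radialExtension e Ψ (simplexWeights t)) 1

/-- The weights `x` on the two cones with apices `a` and `b` over the simplex `t`, glued along
that simplex. -/
noncomputable def gluedWeights {n : ℕ} (a b : W) (t : Fin n → W) (x : Fin (n + 1) → ℝ) : W → ℝ :=
  max (x 0) 0 • Pi.single a (1 : ℝ) + max (-x 0) 0 • Pi.single b (1 : ℝ) +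
    simplexWeights t fun i => x i.succ

theorem simplexWeights_cons {W : Type*} [DecidableEq W] {n : ℕ} (a : W) (t : Fin n → W) (x : Fin (n + 1) → ℝ) :
    simplexWeights (Fin.cons a t : Fin (n + 1) → W) x
      = x 0 • Pi.single a (1 : ℝ) + simplexWeights t fun i => x i.succ := by
  simp [simplexWeights, Fin.sum_univ_succ]

theorem gluedWeights_of_nonneg {W : Type*} [DecidableEq W] {n : ℕ} (a b : W) (t : Fin n → W) {x : Fin (n + 1) → ℝ}
    (hx : 0 ≤ x 0) : gluedWeights a b t x = simplexWeights (Fin.cons a t : Fin (n + 1) → W) x := by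
  rw [gluedWeights, simplexWeights_cons, max_eq_left hx, max_eq_right (by linarith)]
  simp

theorem gluedWeights_of_nonpos {W : Type*} [DecidableEq W] {n : ℕ} (a b : W) (t : Fin n → W) {x : Fin (n + 1) → ℝ}
    (hx : x 0 ≤ 0) : gluedWeights a b t x
      = simplexWeights (Fin.cons b t : Fin (n + 1) → W) (firstReflection n x) := by
  rw [gluedWeights, simplexWeights_cons, max_eq_right hx, max_eq_left (by linarith)]
  simp [firstReflection_apply_zero, firstReflection_apply_succ]

theorem continuous_gluedWeights {W : Type*} [DecidableEq W] {n : ℕ} (a b : W) (t : Fin n → W) :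
    Continuous (gluedWeights a b t) := by
  have := continuous_simplexWeights t
  unfold gluedWeights
  fun_prop

/-- The weight at the apex may vanish, on the common facet, so positivity of the total has to come
from another vertex; this is where `1 ≤ n` enters. -/
theorem simplexWeights_cons_mem_cone {n : ℕ} (hn : 1 ≤ n) {a : W} {t : Fin n → W}
    (ha : IsOrderedSimplex S (Fin.cons a t : Fin (n + 1) → W)) {x : Fin (n + 1) → ℝ}
    (hx0 : 0 ≤ x 0) (hx : ∀ i : Fin n, 0 < x i.succ) :
    simplexWeights (Fin.cons a t : Fin (n + 1) → W) x ∈ realizationCone S := by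
  obtain ⟨hinj, s, hs, hst⟩ := ha
  refine ⟨fun w => ?_, ?_, s, hs, fun w hw => simplexWeights_apply_of_notMem x ?_⟩
  · by_cases hw : w ∈ range (Fin.cons a t : Fin (n + 1) → W)
    · obtain ⟨i, rfl⟩ := hw
      rw [simplexWeights_apply hinj]
      exact Fin.cases hx0 (fun i => (hx i).le) i
    · rw [simplexWeights_apply_of_notMem x hw]
  · rw [sum_simplexWeights, Fin.sum_univ_succ]
    have : Nonempty (Fin n) := ⟨⟨0, hn⟩⟩
    have := Finset.sum_pos (fun i _ => hx i) (Finset.univ_nonempty (α := Fin n))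
    linarith
  · rwa [← hst]

theorem gluedWeights_injective {W : Type*} [DecidableEq W] {n : ℕ} {a b : W} (hab : a ≠ b) {t : Fin n → W}
    (ha : Function.Injective (Fin.cons a t : Fin (n + 1) → W))
    (hb : Function.Injective (Fin.cons b t : Fin (n + 1) → W)) :
    Function.Injective (gluedWeights a b t) := by
  rw [Fin.cons_injective_iff] at ha hb
  have ht : ∀ x i, gluedWeights a b t x (t i) = x i.succ := fun x i => by
    have h1 : t i ≠ a := fun h => ha.1 ⟨i, h⟩
    have h2 : t i ≠ b := fun h => hb.1 ⟨i, h⟩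
    simp [gluedWeights, simplexWeights_apply ha.2, h1, h2]
  -- The positive and negative parts of `x 0` sit at `a` and at `b`, so their difference recovers `x
  -- 0`.
  have h0 : ∀ x, gluedWeights a b t x a - gluedWeights a b t x b = x 0 := fun x => by
    simp only [gluedWeights, Pi.add_apply, simplexWeights_apply_of_notMem _ ha.1,
      simplexWeights_apply_of_notMem _ hb.1, Pi.smul_apply, Pi.single_eq_same,
      Pi.single_eq_of_ne hab, Pi.single_eq_of_ne hab.symm, smul_eq_mul]
    rcases le_total 0 (x 0) with h | h
    · rw [max_eq_left h, max_eq_right (by linarith)]; ring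
    · rw [max_eq_right h, max_eq_left (by linarith)]; ring
  intro x y hxy
  funext i
  refine Fin.cases ?_ (fun i => ?_) i
  · rw [← h0 x, hxy, h0]
  · rw [← ht x, hxy, ht]

/-- A complex embedded into the unit sphere of an `(n+1)`-dimensional space is oriented by the
local degrees of the cones over its `n`-simplices. -/
theorem isOrientation_simplexSign {n : ℕ} (hn : 1 ≤ n) (e : E ≃L[ℝ] (Fin (n + 1) → ℝ))
    {Ψ : (W → ℝ) → E} (hΨ : ContinuousOn Ψ (realization S)) (hinj : InjOn Ψ (realization S))
    (hnorm : ∀ x ∈ realization S, ‖Ψ x‖ = 1) : IsOrientation S n (simplexSign e Ψ) where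
  perm t ht σ := by
    -- Reordering the vertices precomposes the cone with a coordinate permutation, which fixes the
    -- base point `1`.
    have hfun : radialExtension e Ψ (simplexWeights (t ∘ σ))
        = fun x => radialExtension e Ψ (simplexWeights t) (coordPerm σ⁻¹ x) := by
      funext x
      have : simplexWeights (t ∘ σ) x = simplexWeights t (coordPerm σ⁻¹ x) := by
        simp only [simplexWeights, coordPerm_apply]
        rw [← Equiv.sum_comp σ fun j => x (σ⁻¹ j) • (Pi.single (t j) (1 : ℝ) : W → ℝ)]
        simp
      simp only [radialExtension, this]
    have hone : coordPerm σ⁻¹ (1 : Fin (n + 1) → ℝ) = 1 := by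
      funext i; rw [coordPerm_apply]; rfl
    rw [simplexSign, hfun, localSign_comp_coordPerm (U := positiveOrthant (n + 1)), hone,
      Equiv.Perm.sign_inv]
    · rfl
    · exact radialExtension_continuousOn e hΨ (continuous_simplexWeights t).continuousOn
        (simplexWeights_mem_cone ht)
    · exact radialExtension_injOn e hinj hnorm (simplexWeights_injective ht.1).injOn
        (simplexWeights_mem_cone ht)
    · rw [hone]; exact positiveOrthant_mem_nhds_one
  coherent t a b hab ha hb := by
    -- A convex region crossing the common facet `x 0 = 0`. On it the glued cone is injective, so
    -- its local sign is the same at `1` and at the mirror point `one'`; near `one'` it is the cone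
    -- over the second simplex precomposed with a reflection.
    set U : Set (Fin (n + 1) → ℝ) := {x | ∀ i : Fin n, 0 < x i.succ}
    have hUo : IsOpen U := by
      simp only [U, ofPred_forall]
      exact isOpen_iInter_of_finite fun i => isOpen_lt continuous_const (continuous_apply _)
    have hUc : Convex ℝ U := by
      intro x hx y hy r s hr hs hrs i
      have h1 := hx i
      have h2 := hy i
      simp only [Pi.add_apply, Pi.smul_apply, smul_eq_mul]
      rcases hr.eq_or_lt with rfl | hr
      · have : s = 1 := by linarith
        simp [this, h2]
      · positivity
    have hqU : MapsTo (gluedWeights a b t) U (realizationCone S) := by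
      intro x hx
      rcases le_total 0 (x 0) with h | h
      · rw [gluedWeights_of_nonneg a b t h]
        exact simplexWeights_cons_mem_cone hn ha h hx
      · rw [gluedWeights_of_nonpos a b t h]
        refine simplexWeights_cons_mem_cone hn hb ?_ fun i => ?_
        · rw [firstReflection_apply_zero]; linarith
        · rw [firstReflection_apply_succ]; exact hx i
    have hc := radialExtension_continuousOn e hΨ (continuous_gluedWeights a b t).continuousOn hqU
    have hi := radialExtension_injOn e hinj hnorm (gluedWeights_injective hab ha.1 hb.1).injOn hqU
    set one' : Fin (n + 1) → ℝ := firstReflection n 1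
    have hrr : firstReflection n one' = 1 := by
      funext i
      refine Fin.cases ?_ (fun i => ?_) i
      · simp [one', firstReflection_apply_zero]
      · simp [one', firstReflection_apply_succ]
    have h1U : (1 : Fin (n + 1) → ℝ) ∈ U := fun i => one_pos
    have h1U' : one' ∈ U := fun i => by simp [one', firstReflection_apply_succ]
    have hA : simplexSign e Ψ (Fin.cons a t)
        = localSign (radialExtension e Ψ (gluedWeights a b t)) 1 := by
      refine localSign_congr ?_
      filter_upwards [positiveOrthant_mem_nhds_one] with x hx
      simp only [radialExtension, gluedWeights_of_nonneg a b t (hx 0).le]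
    have hB : localSign (radialExtension e Ψ (gluedWeights a b t)) one'
        = -simplexSign e Ψ (Fin.cons b t) := by
      rw [simplexSign, ← hrr, ← localSign_comp_firstReflection (U := positiveOrthant (n + 1))]
      · refine localSign_congr ?_
        have : ∀ᶠ x in 𝓝 one', x 0 < 0 :=
          (isOpen_lt (continuous_apply 0) continuous_const).mem_nhds
            (by simp [one', firstReflection_apply_zero])
        filter_upwards [this] with x hx
        simp only [radialExtension, gluedWeights_of_nonpos a b t hx.le]
      · exact radialExtension_continuousOn e hΨ (continuous_simplexWeights _).continuousOn
          (simplexWeights_mem_cone hb)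
      · exact radialExtension_injOn e hinj hnorm (simplexWeights_injective hb.1).injOn
          (simplexWeights_mem_cone hb)
      · rw [hrr]; exact positiveOrthant_mem_nhds_one
    rw [hA, localSign_eq_of_isPreconnected hc hi hUo hUc.isPreconnected h1U h1U', hB]

/-- Simplices that correspond under a reflection of the sphere have opposite signs. -/
theorem simplexSign_of_reflection {n : ℕ} (e : E ≃L[ℝ] (Fin (n + 1) → ℝ))
    {Ψ : (W → ℝ) → E} (hΨ : ContinuousOn Ψ (realization S)) (hinj : InjOn Ψ (realization S))
    (hnorm : ∀ x ∈ realization S, ‖Ψ x‖ = 1) {t t' : Fin (n + 1) → W} (ht : IsOrderedSimplex S t)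
    (h : ∀ x, x ∈ positiveOrthant (n + 1) → ∑ i, x i = 1 →
      e (Ψ (simplexWeights t' x)) = firstReflection n (e (Ψ (simplexWeights t x)))) :
    simplexSign e Ψ t' = -simplexSign e Ψ t := by
  rw [simplexSign, simplexSign, ← localSign_firstReflection_comp (U := positiveOrthant (n + 1))]
  · refine localSign_congr ?_
    filter_upwards [positiveOrthant_mem_nhds_one] with x hx
    have hpos : 0 < ∑ i, x i := Finset.sum_pos (fun i _ => hx i) Finset.univ_nonempty
    have hs : ∀ t : Fin (n + 1) → W, (∑ i, x i)⁻¹ • simplexWeights t x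
        = simplexWeights t ((∑ i, x i)⁻¹ • x) := fun t => by
      simp [simplexWeights, Finset.smul_sum, smul_smul]
    simp only [radialExtension, sum_simplexWeights, hs, map_smul]
    rw [h]
    · intro i
      have := hx i
      simp only [Pi.smul_apply, smul_eq_mul]
      positivity
    · simp only [Pi.smul_apply, smul_eq_mul, ← Finset.mul_sum]
      exact inv_mul_cancel₀ hpos.ne'
  · exact radialExtension_continuousOn e hΨ (continuous_simplexWeights t).continuousOn
      (simplexWeights_mem_cone ht)
  · exact radialExtension_injOn e hinj hnorm (simplexWeights_injective ht.1).injOn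
      (simplexWeights_mem_cone ht)
  · exact positiveOrthant_mem_nhds_one

end
end

/-! ### The staircase decomposition of a prism -/

/-- The length of the part of `[0, b]` that lies in the unit interval `[i, i + 1]`. -/
noncomputable def unitOverlap (i : ℕ) (b : ℝ) : ℝ := max 0 (min 1 (b - i))

theorem continuous_unitOverlap (i : ℕ) : Continuous (unitOverlap i) := by
  unfold unitOverlap; fun_prop

theorem unitOverlap_mono (i : ℕ) : Monotone (unitOverlap i) := by
  intro a b h
  unfold unitOverlap
  gcongr

theorem unitOverlap_of_le {i : ℕ} {b : ℝ} (h : b ≤ i) : unitOverlap i b = 0 :=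
  max_eq_left ((min_le_right _ _).trans (by linarith))

theorem unitOverlap_of_ge {i : ℕ} {b : ℝ} (h : i + 1 ≤ b) : unitOverlap i b = 1 := by
  rw [unitOverlap, min_eq_left (by linarith), max_eq_right zero_le_one]

theorem unitOverlap_of_mem {i : ℕ} {b : ℝ} (h : i ≤ b) (h' : b ≤ i + 1) :
    unitOverlap i b = b - i := by
  rw [unitOverlap, min_eq_right (by linarith), max_eq_right (by linarith)]

theorem sum_range_unitOverlap (M : ℕ) {b : ℝ} (hb : 0 ≤ b) :
    ∑ i ∈ Finset.range M, unitOverlap i b = min b M := by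
  induction M with
  | zero => simp [hb]
  | succ M ih =>
    rw [Finset.sum_range_succ, ih]
    push_cast
    rcases le_total b M with h | h
    · rw [unitOverlap_of_le h, min_eq_left h, min_eq_left (by linarith), add_zero]
    · rcases le_total b (M + 1) with h' | h'
      · rw [unitOverlap_of_mem h h', min_eq_right h, min_eq_left h']; ring
      · rw [unitOverlap_of_ge h', min_eq_right h, min_eq_right h']

/-- This is the mean height of the interval `[s, s + 1]` distributed over unit levels. Shifting by
one level turns the first sum into the second with coefficients raised by one, and the difference is
the length of `[0, s]`. -/
theorem sum_range_mul_unitOverlap_sub (L : ℕ) {s : ℝ} (hs : 0 ≤ s) (hsL : s ≤ L) :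
    ∑ i ∈ Finset.range (L + 1), (i : ℝ) * (unitOverlap i (s + 1) - unitOverlap i s) = s := by
  have hshift : ∀ i : ℕ, unitOverlap (i + 1) (s + 1) = unitOverlap i s := fun i => by
    simp [unitOverlap]
  have h1 : ∑ i ∈ Finset.range (L + 1), (i : ℝ) * unitOverlap i (s + 1)
      = ∑ i ∈ Finset.range L, ((i : ℝ) + 1) * unitOverlap i s := by
    rw [Finset.sum_range_succ']
    simp [hshift]
  simp only [mul_sub, Finset.sum_sub_distrib]
  rw [h1, Finset.sum_range_succ, unitOverlap_of_le hsL, mul_zero, add_zero,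
    ← Finset.sum_sub_distrib]
  simp only [add_mul, one_mul, add_sub_cancel_left]
  rw [sum_range_unitOverlap L hs, min_eq_left hsL]

section
variable {V : Type*} [Fintype V]

/-- The projection of prism weights to the base. -/
def prismProj {V : Type*} {L : ℕ} (x : V × Fin (L + 1) → ℝ) (v : V) : ℝ := ∑ i, x (v, i)

/-- The mean height of prism weights. -/
def prismHeight {L : ℕ} (x : V × Fin (L + 1) → ℝ) : ℝ := ∑ a, x a * (a.2 : ℝ)

theorem continuous_prismProj {V : Type*} {L : ℕ} : Continuous (prismProj (V := V) (L := L)) := by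
  unfold prismProj; fun_prop

theorem continuous_prismHeight {L : ℕ} : Continuous (prismHeight (V := V) (L := L)) := by
  unfold prismHeight; fun_prop

theorem sum_filter_mem_Icc {y : V → ℝ} (hy : y ∈ stdSimplex ℝ V) (T : Finset V) :
    ∑ u ∈ T, y u ∈ Icc (0 : ℝ) 1 :=
  ⟨Finset.sum_nonneg fun u _ => hy.1 u, hy.2 ▸
    Finset.sum_le_sum_of_subset_of_nonneg (Finset.subset_univ _) fun u _ _ => hy.1 u⟩

theorem sum_prismProj {L : ℕ} (x : V × Fin (L + 1) → ℝ) : ∑ v, prismProj x v = ∑ a, x a := by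
  simp [prismProj, Fintype.sum_prod_type]

theorem prismProj_mem_stdSimplex {L : ℕ} {x : V × Fin (L + 1) → ℝ} (hx : x ∈ stdSimplex ℝ _) :
    prismProj x ∈ stdSimplex ℝ V :=
  ⟨fun _ => Finset.sum_nonneg fun _ _ => hx.1 _, by rw [sum_prismProj, hx.2]⟩

theorem prismHeight_mem_Icc {L : ℕ} {x : V × Fin (L + 1) → ℝ} (hx : x ∈ stdSimplex ℝ _) :
    prismHeight x ∈ Icc (0 : ℝ) L := by
  refine ⟨Finset.sum_nonneg fun a _ => mul_nonneg (hx.1 a) (Nat.cast_nonneg _), ?_⟩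
  calc prismHeight x ≤ ∑ a, x a * (L : ℝ) := Finset.sum_le_sum fun a _ =>
        mul_le_mul_of_nonneg_left (by exact_mod_cast Fin.is_le a.2) (hx.1 a)
    _ = L := by rw [← Finset.sum_mul, hx.2, one_mul]

variable [LinearOrder V]

/-- For nonnegative `y` the segments of length `y v`, laid end to end in the order of `V`, tile an
interval starting at `s`, so increments of `G` telescope. The induction adds the largest element,
which leaves earlier segments in place. -/
theorem sum_telescope_order {V : Type*} [LinearOrder V] (G : ℝ → ℝ) (s : ℝ) (y : V → ℝ) (T : Finset V) :
    ∑ v ∈ T, (G (s + ∑ u ∈ T with u ≤ v, y u) - G (s + ∑ u ∈ T with u < v, y u))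
      = G (s + ∑ u ∈ T, y u) - G s := by
  induction T using Finset.induction_on_max with
  | empty => simp
  | insert a T hT ih =>
    have ha : a ∉ T := fun h => lt_irrefl _ (hT a h)
    rw [Finset.sum_insert ha]
    have h1 : (insert a T).filter (· ≤ a) = insert a T := by
      refine Finset.filter_true_of_mem fun u hu => ?_
      rcases Finset.mem_insert.1 hu with rfl | hu
      · exact le_rfl
      · exact (hT u hu).le
    have h2 : (insert a T).filter (· < a) = T := by
      rw [Finset.filter_insert, if_neg (lt_irrefl a)]
      exact Finset.filter_true_of_mem hT
    have h3 : ∀ v ∈ T, (insert a T).filter (· ≤ v) = T.filter (· ≤ v) := fun v hv => by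
      rw [Finset.filter_insert, if_neg (not_le.2 (hT v hv))]
    have h4 : ∀ v ∈ T, (insert a T).filter (· < v) = T.filter (· < v) := fun v hv => by
      rw [Finset.filter_insert, if_neg (hT v hv).not_gt]
    have h5 : ∑ v ∈ T, (G (s + ∑ u ∈ insert a T with u ≤ v, y u)
        - G (s + ∑ u ∈ insert a T with u < v, y u)) = G (s + ∑ u ∈ T, y u) - G s := by
      rw [← ih]
      exact Finset.sum_congr rfl fun v hv => by rw [h3 v hv, h4 v hv]
    rw [h1, h2, h5]
    ring

variable {L : ℕ}

/-- The weights on the prism vertices that lie over the weights `y` at height `s`. -/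
noncomputable def prismLift (L : ℕ) (y : V → ℝ) (s : ℝ) (a : V × Fin (L + 1)) : ℝ :=
  unitOverlap a.2 (s + ∑ u with u ≤ a.1, y u) - unitOverlap a.2 (s + ∑ u with u < a.1, y u)

theorem continuous_prismLift : Continuous fun z : (V → ℝ) × ℝ => prismLift L z.1 z.2 := by
  unfold prismLift
  have := continuous_unitOverlap
  fun_prop

variable {y : V → ℝ} {s : ℝ}

theorem sum_filter_lt_add (y : V → ℝ) (v : V) :
    ∑ u with u ≤ v, y u = (∑ u with u < v, y u) + y v := by
  have : Finset.univ.filter (· ≤ v) = insert v (Finset.univ.filter (· < v)) := by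
    ext u; simp [le_iff_eq_or_lt]
  rw [this, Finset.sum_insert (by simp), add_comm]

theorem prismLift_nonneg (hy : y ∈ stdSimplex ℝ V) (a : V × Fin (L + 1)) :
    0 ≤ prismLift L y s a := by
  refine sub_nonneg.2 (unitOverlap_mono _ ?_)
  rw [sum_filter_lt_add]
  linarith [hy.1 a.1]

/-- `prismLift` cuts `[s, s + 1]` into consecutive segments of length `y v` and gives `(v, i)` the
length of the part of the `v`-segment in `[i, i + 1]`. These parts add up to `y v`, as `s + 1 ≤ L +
1`. -/
theorem prismProj_prismLift (hy : y ∈ stdSimplex ℝ V) (hs : 0 ≤ s) (hsL : s ≤ L) :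
    prismProj (prismLift L y s) = y := by
  funext v
  have h1 := sum_filter_mem_Icc hy (Finset.univ.filter (· ≤ v))
  have h2 := sum_filter_mem_Icc hy (Finset.univ.filter (· < v))
  simp only [prismProj, prismLift, Finset.sum_sub_distrib]
  rw [Fin.sum_univ_eq_sum_range fun i => unitOverlap i (s + ∑ u with u ≤ v, y u),
    Fin.sum_univ_eq_sum_range fun i => unitOverlap i (s + ∑ u with u < v, y u),
    sum_range_unitOverlap _ (by linarith [h1.1]), sum_range_unitOverlap _ (by linarith [h2.1]),
    min_eq_left (by push_cast; linarith [h1.2]), min_eq_left (by push_cast; linarith [h2.2]),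
    sum_filter_lt_add]
  ring

theorem prismHeight_prismLift (hy : y ∈ stdSimplex ℝ V) (hs : 0 ≤ s) (hsL : s ≤ L) :
    prismHeight (prismLift L y s) = s := by
  rw [prismHeight, Fintype.sum_prod_type, Finset.sum_comm]
  simp only [prismLift, ← Finset.sum_mul]
  simp only [fun i : Fin (L + 1) => sum_telescope_order (unitOverlap i) s y Finset.univ, hy.2]
  rw [Fin.sum_univ_eq_sum_range fun i => (unitOverlap i (s + 1) - unitOverlap i s) * (i : ℝ)]
  simp only [mul_comm _ ((_ : ℕ) : ℝ)]
  exact sum_range_mul_unitOverlap_sub L hs hsL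

theorem prismLift_mem_stdSimplex (hy : y ∈ stdSimplex ℝ V) (hs : 0 ≤ s) (hsL : s ≤ L) :
    prismLift L y s ∈ stdSimplex ℝ (V × Fin (L + 1)) :=
  ⟨prismLift_nonneg hy, by rw [← sum_prismProj, prismProj_prismLift hy hs hsL, hy.2]⟩

theorem lt_of_prismLift_ne_zero (hy : y ∈ stdSimplex ℝ V) {a : V × Fin (L + 1)}
    (ha : prismLift L y s a ≠ 0) :
    (a.2 : ℝ) < s + ∑ u with u ≤ a.1, y u ∧ s + ∑ u with u < a.1, y u < (a.2 : ℝ) + 1 := by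
  have hle : s + ∑ u with u < a.1, y u ≤ s + ∑ u with u ≤ a.1, y u := by
    rw [sum_filter_lt_add]; linarith [hy.1 a.1]
  constructor <;> by_contra! h
  · exact ha (by rw [prismLift, unitOverlap_of_le h, unitOverlap_of_le (hle.trans h), sub_zero])
  · exact ha (by rw [prismLift, unitOverlap_of_ge h, unitOverlap_of_ge (h.trans hle), sub_self])

/-- An interval of length one overlaps at most two consecutive unit intervals. -/
theorem prismLift_spread (hy : y ∈ stdSimplex ℝ V) {a b : V × Fin (L + 1)}
    (ha : prismLift L y s a ≠ 0) (hb : prismLift L y s b ≠ 0) : (a.2 : ℕ) ≤ b.2 + 1 := by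
  have h1 := (lt_of_prismLift_ne_zero hy ha).1
  have h2 := (lt_of_prismLift_ne_zero hy hb).2
  have h3 := (sum_filter_mem_Icc hy (Finset.univ.filter (· ≤ a.1))).2
  have h4 := (sum_filter_mem_Icc hy (Finset.univ.filter (· < b.1))).1
  have : ((a.2 : ℕ) : ℝ) < ((b.2 + 2 : ℕ) : ℝ) := by push_cast; linarith
  have := Nat.cast_lt.1 this
  omega

/-- The segments are laid out in the order of `V`, so lower levels are filled by earlier vertices.
-/
theorem prismLift_le_of_lt (hy : y ∈ stdSimplex ℝ V) {a b : V × Fin (L + 1)}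
    (ha : prismLift L y s a ≠ 0) (hb : prismLift L y s b ≠ 0) (hab : a.2 < b.2) : a.1 ≤ b.1 := by
  have h1 := (lt_of_prismLift_ne_zero hy hb).1
  have h2 := (lt_of_prismLift_ne_zero hy ha).2
  by_contra! hlt
  have h3 : ∑ u with u ≤ b.1, y u ≤ ∑ u with u < a.1, y u :=
    Finset.sum_le_sum_of_subset_of_nonneg
      (Finset.monotone_filter_right _ fun u _ hu => lt_of_le_of_lt hu hlt) fun u _ _ => hy.1 u
  have h4 : ((a.2 + 1 : ℕ) : ℝ) ≤ ((b.2 : ℕ) : ℝ) := Nat.cast_le.2 hab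
  push_cast at h4
  linarith

/-- The spread condition leaves only two levels `j` and `j + 1`, with masses `A` and `B`, so the
height is `j + θ` where `θ` is the total of `B`. The chain condition says that all of `A` is laid
down before any of `B`, which is how `prismLift` divides the interval. -/
theorem prismLift_proj_height {x : V × Fin (L + 1) → ℝ} (hx : x ∈ stdSimplex ℝ _)
    (hspread : ∀ a b, x a ≠ 0 → x b ≠ 0 → (a.2 : ℕ) ≤ b.2 + 1)
    (hchain : ∀ a b, x a ≠ 0 → x b ≠ 0 → a.2 < b.2 → a.1 ≤ b.1) :
    prismLift L (prismProj x) (prismHeight x) = x := by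
  obtain ⟨a₀, ha₀, hmin⟩ : ∃ a₀, x a₀ ≠ 0 ∧ ∀ a, x a ≠ 0 → a₀.2 ≤ a.2 := by
    have hne : (Finset.univ.filter fun a => x a ≠ 0).Nonempty := by
      by_contra h
      rw [Finset.not_nonempty_iff_eq_empty, Finset.filter_eq_empty_iff] at h
      have h2 := hx.2
      rw [Finset.sum_eq_zero fun a ha => not_not.1 (h ha)] at h2
      exact zero_ne_one h2
    obtain ⟨a₀, h0, h⟩ := Finset.exists_min_image _ (fun a => a.2) hne
    exact ⟨a₀, (Finset.mem_filter.1 h0).2, fun a ha => h a (by simpa using ha)⟩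
  set j := a₀.2
  have hlev : ∀ v i, x (v, i) ≠ 0 → i = j ∨ (i : ℕ) = j + 1 := fun v i h => by
    have h1 := hmin (v, i) h
    have h2 := hspread (v, i) a₀ h ha₀
    rcases h1.eq_or_lt with h3 | h3
    · exact Or.inl h3.symm
    · have : (j : ℕ) < i := h3
      right
      change (i : ℕ) ≤ j + 1 at h2
      omega
  set A : V → ℝ := fun v => x (v, j)
  set B : V → ℝ := fun v => prismProj x v - x (v, j)
  have hBsum : ∀ v, B v = ∑ i ∈ Finset.univ.erase j, x (v, i) := fun v => by
    simp only [B, prismProj]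
    rw [← Finset.add_sum_erase _ _ (Finset.mem_univ j)]; ring
  have hA0 : ∀ v, 0 ≤ A v := fun v => hx.1 _
  have hB0 : ∀ v, 0 ≤ B v := fun v => by
    rw [hBsum]; exact Finset.sum_nonneg fun i _ => hx.1 _
  have hAB : ∀ v, prismProj x v = A v + B v := fun v => by simp [A, B]
  have hABsum : ∑ v, A v + ∑ v, B v = 1 := by
    rw [← Finset.sum_add_distrib, ← hx.2, ← sum_prismProj]
    exact Finset.sum_congr rfl fun v _ => (hAB v).symm
  set θ := ∑ v, B v
  have hθ0 : 0 ≤ θ := Finset.sum_nonneg fun v _ => hB0 v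
  have hheight : prismHeight x = j + θ := by
    have h1 : ∀ a : V × Fin (L + 1), x a * (a.2 : ℝ) = x a * j + (if a.2 = j then 0 else x a) := by
      rintro ⟨v, i⟩
      by_cases h : x (v, i) = 0
      · simp [h]
      · rcases hlev v i h with h' | h'
        · simp [h']
        · have : i ≠ j := fun h => by rw [h] at h'; omega
          simp only [h', if_neg this]; push_cast; ring
    rw [prismHeight, Finset.sum_congr rfl fun a _ => h1 a, Finset.sum_add_distrib, ← Finset.sum_mul,
      hx.2, one_mul, Fintype.sum_prod_type]
    congr 1
    refine Finset.sum_congr rfl fun v _ => ?_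
    rw [hBsum, ← Finset.filter_ne' , Finset.sum_filter]
    refine Finset.sum_congr rfl fun i _ => ?_
    by_cases h : i = j <;> simp [h]
  have hBne : ∀ v, B v ≠ 0 → ∃ i, x (v, i) ≠ 0 ∧ (i : ℕ) = j + 1 := fun v h => by
    rw [hBsum] at h
    obtain ⟨i, hi, hxi⟩ := Finset.exists_ne_zero_of_sum_ne_zero h
    exact ⟨i, hxi, (hlev v i hxi).resolve_left (Finset.mem_erase.1 hi).1⟩
  -- the staircase: mass of the lower level is exhausted before the upper level begins
  have hstair : ∀ T : Finset V, (∀ u ∈ T, ∀ w, w ≤ u → w ∈ T) →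
      unitOverlap j (prismHeight x + ∑ u ∈ T, prismProj x u) = θ + ∑ u ∈ T, A u := by
    intro T hT
    have hTA : ∑ u ∈ T, A u ≤ ∑ u, A u :=
      Finset.sum_le_sum_of_subset_of_nonneg (Finset.subset_univ _) fun u _ _ => hA0 u
    have hTA0 : 0 ≤ ∑ u ∈ T, A u := Finset.sum_nonneg fun u _ => hA0 u
    have hTB0 : 0 ≤ ∑ u ∈ T, B u := Finset.sum_nonneg fun u _ => hB0 u
    rw [hheight, Finset.sum_congr rfl fun u _ => hAB u, Finset.sum_add_distrib]
    -- If the initial segment `T` has reached upper mass, it already contains all lower mass and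
    -- level `j` is full; otherwise the interval has not yet left level `j`.
    by_cases hB : ∃ u ∈ T, B u ≠ 0
    · obtain ⟨u, huT, hu⟩ := hB
      obtain ⟨i, hi, hij⟩ := hBne u hu
      have hall : ∑ u ∈ T, A u = ∑ u, A u := by
        refine Finset.sum_subset (Finset.subset_univ _) fun w _ hw => ?_
        by_contra hAw
        refine hw (hT u huT w (hchain (w, j) (u, i) hAw hi ?_))
        change (j : ℕ) < i
        omega
      rw [unitOverlap_of_ge (by linarith)]
      linarith
    · push Not at hB
      rw [Finset.sum_eq_zero hB, add_zero, unitOverlap_of_mem (by linarith) (by linarith)]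
      ring
  have hP := prismProj_mem_stdSimplex hx
  have hle : ∀ v : V, ∀ u ∈ Finset.univ.filter (· ≤ v), ∀ w, w ≤ u → w ∈ Finset.univ.filter (· ≤ v) := by
    intro v u hu w hw
    simp only [Finset.mem_filter, Finset.mem_univ, true_and] at hu ⊢
    exact hw.trans hu
  have hlt : ∀ v : V, ∀ u ∈ Finset.univ.filter (· < v), ∀ w, w ≤ u → w ∈ Finset.univ.filter (· < v) := by
    intro v u hu w hw
    simp only [Finset.mem_filter, Finset.mem_univ, true_and] at hu ⊢
    exact hw.trans_lt hu
  have hθ1 : θ ≤ 1 := by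
    have : 0 ≤ ∑ v, A v := Finset.sum_nonneg fun v _ => hA0 v
    linarith
  have hj : ∀ v, prismLift L (prismProj x) (prismHeight x) (v, j) = x (v, j) := by
    intro v
    simp only [prismLift]
    rw [hstair _ (hle v), hstair _ (hlt v), sum_filter_lt_add]
    simp only [A]; ring
  have hup : ∀ (i : Fin (L + 1)), (i : ℕ) = j + 1 → ∀ T : Finset V, (∀ u ∈ T, ∀ w, w ≤ u → w ∈ T) →
      unitOverlap i (prismHeight x + ∑ u ∈ T, prismProj x u) = ∑ u ∈ T, B u := by
    intro i hi T hT
    have h1 := hstair T hT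
    have h2 := sum_filter_mem_Icc hP T
    have h3 : ∑ u ∈ T, prismProj x u = ∑ u ∈ T, A u + ∑ u ∈ T, B u := by
      rw [← Finset.sum_add_distrib]; exact Finset.sum_congr rfl fun u _ => hAB u
    have hi' : ((i : ℕ) : ℝ) = j + 1 := by rw [hi]; push_cast; rfl
    rcases le_total (θ + ∑ u ∈ T, prismProj x u) 1 with h | h
    · rw [hheight, unitOverlap_of_mem (by linarith [h2.1]) (by linarith)] at h1
      rw [hheight, unitOverlap_of_le (by linarith)]
      linarith
    · rw [hheight, unitOverlap_of_ge (by linarith)] at h1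
      rw [hheight, unitOverlap_of_mem (by linarith) (by linarith [h2.2])]
      linarith
  funext ⟨v, i⟩
  rcases lt_trichotomy (i : ℕ) j with h | h | h
  · have hx0 : x (v, i) = 0 := by
      by_contra hne
      rcases hlev v i hne with h' | h'
      · rw [h'] at h; exact lt_irrefl _ h
      · omega
    have hc : ((i + 1 : ℕ) : ℝ) ≤ ((j : ℕ) : ℝ) := Nat.cast_le.2 h
    push_cast at hc
    have h1 := (sum_filter_mem_Icc hP (Finset.univ.filter (· ≤ v))).1
    have h2 := (sum_filter_mem_Icc hP (Finset.univ.filter (· < v))).1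
    rw [hx0, prismLift, unitOverlap_of_ge (by rw [hheight]; linarith),
      unitOverlap_of_ge (by rw [hheight]; linarith), sub_self]
  · rw [Fin.ext h]; exact hj v
  · by_cases h' : (i : ℕ) = j + 1
    · have hBv : B v = x (v, i) := by
        rw [hBsum]
        refine Finset.sum_eq_single_of_mem i (Finset.mem_erase.2 ⟨fun h => by simp [h] at h', Finset.mem_univ _⟩) ?_
        intro k hk hki
        by_contra hne
        rcases hlev v k hne with h'' | h''
        · exact (Finset.mem_erase.1 hk).1 h''
        · exact hki (Fin.ext (h''.trans h'.symm))
      simp only [prismLift]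
      rw [hup i h' _ (hle v), hup i h' _ (hlt v), sum_filter_lt_add, hBv]
      ring
    · have hx0 : x (v, i) = 0 := by
        by_contra hne
        rcases hlev v i hne with h'' | h''
        · rw [h''] at h; exact lt_irrefl _ h
        · exact h' h''
      have hc : ((j + 2 : ℕ) : ℝ) ≤ ((i : ℕ) : ℝ) := Nat.cast_le.2 (by omega)
      push_cast at hc
      have h1 := (sum_filter_mem_Icc hP (Finset.univ.filter (· ≤ v))).2
      have h2 := (sum_filter_mem_Icc hP (Finset.univ.filter (· < v))).2
      rw [hx0, prismLift, unitOverlap_of_le (by rw [hheight]; linarith),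
        unitOverlap_of_le (by rw [hheight]; linarith), sub_self]

end

/-! ### Homeomorphisms of sets as pairs of total maps -/

/-- `H` and `K` are mutually inverse homeomorphisms between the sets `X` and `Y`. -/
structure IsChart {E F : Type*} [TopologicalSpace E] [TopologicalSpace F] (X : Set E) (Y : Set F)
    (H : E → F) (K : F → E) : Prop where
  continuousOn : ContinuousOn H X
  continuousOn_symm : ContinuousOn K Y
  mapsTo : MapsTo H X Y
  mapsTo_symm : MapsTo K Y X
  leftInvOn : LeftInvOn K H X
  rightInvOn : LeftInvOn H K Y

theorem Homeomorph.exists_isChart {E F : Type*} [TopologicalSpace E] [TopologicalSpace F] [Zero E]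
    [Zero F] {X : Set E} {Y : Set F} (h : X ≃ₜ Y) : ∃ H K, IsChart X Y H K := by
  classical
  have hH : ∀ x (hx : x ∈ X), (if hx : x ∈ X then (h ⟨x, hx⟩ : F) else 0) = h ⟨x, hx⟩ :=
    fun x hx => dif_pos hx
  have hK : ∀ y (hy : y ∈ Y), (if hy : y ∈ Y then (h.symm ⟨y, hy⟩ : E) else 0) = h.symm ⟨y, hy⟩ :=
    fun y hy => dif_pos hy
  refine ⟨fun x => if hx : x ∈ X then h ⟨x, hx⟩ else 0,
    fun y => if hy : y ∈ Y then h.symm ⟨y, hy⟩ else 0, ?_, ?_, ?_, ?_, ?_, ?_⟩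
  · rw [continuousOn_iff_continuous_domRestrict]
    refine (continuous_subtype_val.comp h.continuous).congr fun x => ?_
    exact (hH x x.2).symm
  · rw [continuousOn_iff_continuous_domRestrict]
    refine (continuous_subtype_val.comp h.symm.continuous).congr fun y => ?_
    exact (hK y y.2).symm
  · intro x hx
    simp only [hH x hx]
    exact (h ⟨x, hx⟩).2
  · intro y hy
    simp only [hK y hy]
    exact (h.symm ⟨y, hy⟩).2
  · intro x hx
    simp [hx]
  · intro y hy
    simp [hy]

/-- Mutually inverse continuous maps between two sets form a homeomorphism. -/
def IsChart.homeomorph {E F : Type*} [TopologicalSpace E] [TopologicalSpace F] {X : Set E}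
    {Y : Set F} {H : E → F} {K : F → E} (h : IsChart X Y H K) : X ≃ₜ Y where
  toFun x := ⟨H x, h.mapsTo x.2⟩
  invFun y := ⟨K y, h.mapsTo_symm y.2⟩
  left_inv x := Subtype.ext (h.leftInvOn x.2)
  right_inv y := Subtype.ext (h.rightInvOn y.2)
  continuous_toFun := (h.continuousOn.domRestrict).subtype_mk _
  continuous_invFun := (h.continuousOn_symm.domRestrict).subtype_mk _

/-! ### The boundary subcomplex of a triangulated disc -/

section
variable {V : Type*} [Fintype V] {D : AbstractSimplicialComplex V}

open scoped Classical in
/-- The vertices at which the weights `x` do not vanish. -/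
noncomputable def weightSupport (x : V → ℝ) : Finset V := Finset.univ.filter fun v => x v ≠ 0

theorem mem_weightSupport {x : V → ℝ} {v : V} : v ∈ weightSupport x ↔ x v ≠ 0 := by
  simp [weightSupport]

theorem weightSupport_nonempty {x : V → ℝ} (hx : x ∈ stdSimplex ℝ V) :
    (weightSupport x).Nonempty := by
  by_contra h
  rw [Finset.not_nonempty_iff_eq_empty] at h
  have h2 := hx.2
  rw [Finset.sum_eq_zero fun v _ => ?_] at h2
  · exact zero_ne_one h2
  · by_contra hv
    simpa [h] using mem_weightSupport.2 hv

theorem mem_realization_iff {x : V → ℝ} :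
    x ∈ realization D ↔ x ∈ stdSimplex ℝ V ∧ weightSupport x ∈ D.faces := by
  constructor
  · rintro ⟨hx, s, hs, hxs⟩
    refine ⟨hx, AbstractSimplicialComplex.mem_faces_of_subset hs (fun v hv => ?_)
      (weightSupport_nonempty hx)⟩
    by_contra h
    exact mem_weightSupport.1 hv (hxs v h)
  · rintro ⟨hx, hs⟩
    exact ⟨hx, _, hs, fun v hv => by simpa [mem_weightSupport] using hv⟩

variable {n : ℕ} {H : (V → ℝ) → EuclideanSpace ℝ (Fin n)} {K : EuclideanSpace ℝ (Fin n) → V → ℝ}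

/-- The faces of a triangulated disc that the chart `H` maps to the boundary sphere. -/
def boundaryFaces (D : AbstractSimplicialComplex V) (H : (V → ℝ) → EuclideanSpace ℝ (Fin n)) :
    Set (Finset V) :=
  {s | s ∈ D.faces ∧ ∀ x ∈ realization D, (∀ v, v ∉ s → x v = 0) → ‖H x‖ = 1}

theorem mem_boundaryFaces_of_subset {s t : Finset V} (hs : s ∈ boundaryFaces D H) (hts : t ⊆ s)
    (ht : t.Nonempty) : t ∈ boundaryFaces D H :=
  ⟨AbstractSimplicialComplex.mem_faces_of_subset hs.1 hts ht,
    fun x hx hxt => hs.2 x hx fun v hv => hxt v fun h => hv (hts h)⟩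

/-- Points of `D` near `y` have support containing that of `y`, so translation by `x - y` keeps them
in the same faces and carries a neighbourhood of `y` injectively into the realization, near `x`.
Read through the chart, invariance of domain makes `H x` an interior point of the ball. -/
theorem norm_lt_one_of_weightSupport_eq
    (hc : IsChart (realization D) (closedBall (0 : EuclideanSpace ℝ (Fin n)) 1) H K)
    {x y : V → ℝ} (hx : x ∈ realization D) (hy : y ∈ realization D)
    (hxy : weightSupport x = weightSupport y) (hlt : ‖H y‖ < 1) : ‖H x‖ < 1 := by
  have hsupp : ∀ v, x v ≠ 0 ↔ y v ≠ 0 := fun v => by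
    rw [← mem_weightSupport, hxy, mem_weightSupport]
  set O : Set (V → ℝ) := {z | ∀ v, y v ≠ 0 → 0 < z v ∧ 0 < z v + (x v - y v)}
  have hO : IsOpen O := by
    have : O = ⋂ v, {z | y v ≠ 0 → 0 < z v ∧ 0 < z v + (x v - y v)} := by
      ext z; simp [O]
    rw [this]
    refine isOpen_iInter_of_finite fun v => ?_
    by_cases hv : y v = 0
    · simp [hv]
    · simp only [ne_eq, hv, not_false_eq_true, forall_const]
      exact (isOpen_lt continuous_const (continuous_apply v)).inter
        (isOpen_lt continuous_const ((continuous_apply v).add continuous_const))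
  set U : Set (EuclideanSpace ℝ (Fin n)) := ball 0 1 ∩ K ⁻¹' O
  have hU : IsOpen U :=
    (hc.continuousOn_symm.mono ball_subset_closedBall).isOpen_inter_preimage isOpen_ball hO
  have hUc : U ⊆ closedBall 0 1 := inter_subset_left.trans ball_subset_closedBall
  have hmap : MapsTo (fun w => K w + (x - y)) U (realization D) := by
    rintro w ⟨hw, hwO⟩
    obtain ⟨hz, τ, hτ, hzτ⟩ := hc.mapsTo_symm (ball_subset_closedBall hw)
    have hzero : ∀ v, y v = 0 → x v = 0 := fun v hv => by
      by_contra h; exact (hsupp v).1 h hv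
    refine ⟨⟨fun v => ?_, ?_⟩, τ, hτ, fun v hv => ?_⟩
    · by_cases hv : y v = 0
      · simpa [hv, hzero v hv] using hz.1 v
      · exact (hwO v hv).2.le
    · simp only [Pi.add_apply, Pi.sub_apply, Finset.sum_add_distrib, Finset.sum_sub_distrib]
      rw [hz.2, hx.1.2, hy.1.2]; ring
    · have hyv : y v = 0 := by
        by_contra h
        exact (hwO v h).1.ne' (hzτ v hv)
      simp [hzτ v hv, hyv, hzero v hyv]
  have hHy : H y ∈ U := by
    refine ⟨by simpa using hlt, ?_⟩
    change K (H y) ∈ O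
    rw [hc.leftInvOn hy]
    intro v hv
    have h1 := lt_of_le_of_ne (hy.1.1 v) (Ne.symm hv)
    have h2 := lt_of_le_of_ne (hx.1.1 v) (Ne.symm ((hsupp v).2 hv))
    exact ⟨h1, by linarith⟩
  have himg := image_mem_nhds_of_injOn_of_equiv (EuclideanSpace.equiv (Fin n) ℝ)
    (EuclideanSpace.equiv (Fin n) ℝ) (φ := fun w => H (K w + (x - y)))
    (hc.continuousOn.comp ((hc.continuousOn_symm.mono hUc).add continuousOn_const) hmap)
    (fun a ha b hb hab => hc.rightInvOn.injOn (hUc ha) (hUc hb)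
      (add_right_cancel (hc.leftInvOn.injOn (hmap ha) (hmap hb) hab)))
    (hU.mem_nhds hHy)
  simp only [hc.leftInvOn hy, add_sub_cancel] at himg
  have hint : H x ∈ interior (closedBall (0 : EuclideanSpace ℝ (Fin n)) 1) := by
    refine mem_interior_iff_mem_nhds.2 (mem_of_superset himg ?_)
    rintro _ ⟨w, hw, rfl⟩
    exact hc.mapsTo (hmap hw)
  rw [interior_closedBall _ one_ne_zero] at hint
  simpa using hint

/-- The points mapped to the boundary sphere form the realization of the boundary faces. -/
theorem weightSupport_mem_boundaryFaces
    (hc : IsChart (realization D) (closedBall (0 : EuclideanSpace ℝ (Fin n)) 1) H K)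
    {x : V → ℝ} (hx : x ∈ realization D) (h1 : ‖H x‖ = 1) :
    weightSupport x ∈ boundaryFaces D H := by
  obtain ⟨hxs, hxf⟩ := mem_realization_iff.1 hx
  refine ⟨hxf, fun z hz hzx => ?_⟩
  -- On the segment from `z` to `x`, every point but possibly `z` has the support of `x` and so goes
  -- to the boundary; `z` follows by continuity.
  set γ : ℝ → V → ℝ := fun t => (1 - t) • z + t • x
  have hγc : Continuous γ := by fun_prop
  have hγ : ∀ t ∈ Icc (0 : ℝ) 1, γ t ∈ realization D := by
    intro t ht
    refine ⟨(convex_stdSimplex ℝ V) hz.1 hxs (by linarith [ht.2]) ht.1 (by ring), _, hxf,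
      fun v hv => ?_⟩
    have : x v = 0 := by simpa [mem_weightSupport] using hv
    simp [γ, hzx v hv, this]
  have hγ1 : ∀ t ∈ Ioc (0 : ℝ) 1, ‖H (γ t)‖ = 1 := by
    intro t ht
    have hmem := hγ t ⟨ht.1.le, ht.2⟩
    have hsupp : weightSupport x = weightSupport (γ t) := by
      ext v
      rw [mem_weightSupport, mem_weightSupport]
      constructor
      · intro hv
        have h2 := lt_of_le_of_ne (hxs.1 v) (Ne.symm hv)
        have h3 := hz.1.1 v
        have h4 : 0 ≤ (1 - t) * z v := mul_nonneg (by linarith [ht.2]) h3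
        have h5 : 0 < t * x v := mul_pos ht.1 h2
        simp only [γ, Pi.add_apply, Pi.smul_apply, smul_eq_mul]
        linarith
      · intro hv hxv
        refine hv ?_
        simp [γ, hxv, hzx v (by simp [mem_weightSupport, hxv])]
    refine le_antisymm (by simpa using hc.mapsTo hmem) ?_
    by_contra! hlt
    exact (norm_lt_one_of_weightSupport_eq hc hx hmem hsupp hlt).ne h1
  have hcont : ContinuousOn (fun t => ‖H (γ t)‖) (Icc 0 1) :=
    (hc.continuousOn.comp hγc.continuousOn hγ).norm
  have hlim : Tendsto (fun t => ‖H (γ t)‖) (𝓝[>] 0) (𝓝 ‖H (γ 0)‖) :=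
    (hcont 0 (by simp)).mono_left (nhdsWithin_le_of_mem
      (mem_of_superset (Ioc_mem_nhdsGT one_pos) Ioc_subset_Icc_self))
  have hlim1 : Tendsto (fun t => ‖H (γ t)‖) (𝓝[>] 0) (𝓝 1) :=
    tendsto_const_nhds.congr' (by
      filter_upwards [Ioc_mem_nhdsGT (zero_lt_one' ℝ)] with t ht
      exact (hγ1 t ht).symm)
  have := tendsto_nhds_unique hlim hlim1
  simpa [γ] using this

/-- The boundary of a triangulated `n`-disc contains an `(n-1)`-simplex. -/
theorem exists_mem_boundaryFaces_card (hn : 1 ≤ n)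
    (hc : IsChart (realization D) (closedBall (0 : EuclideanSpace ℝ (Fin n)) 1) H K) :
    ∃ s ∈ boundaryFaces D H, s.card = n := by
  classical
  have : Nonempty (Fin n) := ⟨⟨0, hn⟩⟩
  obtain ⟨w₀, hw₀⟩ : ∃ w : EuclideanSpace ℝ (Fin n), ‖w‖ = 1 := exists_norm_eq _ zero_le_one
  have hw₀b : w₀ ∈ closedBall (0 : EuclideanSpace ℝ (Fin n)) 1 := by simp [hw₀]
  have hne : (Finset.univ.filter fun s => s ∈ boundaryFaces D H).Nonempty :=
    ⟨_, Finset.mem_filter.2 ⟨Finset.mem_univ _, weightSupport_mem_boundaryFaces hc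
      (hc.mapsTo_symm hw₀b) (by rw [hc.rightInvOn hw₀b, hw₀])⟩⟩
  -- Where all weights on a largest boundary face `s` are positive, maximality makes the support
  -- exactly `s`. This gives an open set `U` on which `w ↦ ‖w‖ • R w` is an embedding into `ℝ^s`, so
  -- `n ≤ s.card`.
  obtain ⟨s, hs, hmax⟩ := Finset.exists_max_image _ Finset.card hne
  have hs := (Finset.mem_filter.1 hs).2
  have hsne : s.Nonempty := (D.isRelLowerSet_faces hs.1).1
  have hspos : (0 : ℝ) < s.card := by exact_mod_cast hsne.card_pos
  suffices n ≤ s.card by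
    obtain ⟨t, hts, ht⟩ := Finset.exists_subset_card_eq this
    exact ⟨t, mem_boundaryFaces_of_subset hs hts (Finset.card_pos.1 (by omega)), ht⟩
  set R : EuclideanSpace ℝ (Fin n) → V → ℝ := fun w => K (‖w‖⁻¹ • w)
  have hunit : ∀ w : EuclideanSpace ℝ (Fin n), w ≠ 0 → ‖‖w‖⁻¹ • w‖ = 1 := fun w hw => by
    rw [norm_smul, norm_inv, norm_norm, inv_mul_cancel₀ (norm_ne_zero_iff.2 hw)]
  have hball : MapsTo (fun w : EuclideanSpace ℝ (Fin n) => ‖w‖⁻¹ • w) {0}ᶜ (closedBall 0 1) :=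
    fun w hw => by simpa using (hunit w hw).le
  have hR : ContinuousOn R {0}ᶜ := hc.continuousOn_symm.comp
    ((continuousOn_id.norm.inv₀ fun w hw => norm_ne_zero_iff.2 hw).smul continuousOn_id) hball
  set U : Set (EuclideanSpace ℝ (Fin n)) := {0}ᶜ ∩ R ⁻¹' {z | ∀ v ∈ s, 0 < z v}
  have hO : IsOpen {z : V → ℝ | ∀ v ∈ s, 0 < z v} := by
    simp only [ofPred_forall]
    exact isOpen_biInter_finset fun v _ => isOpen_lt continuous_const (continuous_apply v)
  have hU : IsOpen U := hR.isOpen_inter_preimage isOpen_compl_singleton hO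
  have hUne : U.Nonempty := by
    set b : V → ℝ := fun v => if v ∈ s then (s.card : ℝ)⁻¹ else 0
    have hb : b ∈ realization D := by
      refine ⟨⟨fun v => ?_, ?_⟩, s, hs.1, fun v hv => if_neg hv⟩
      · simp only [b]; split_ifs <;> positivity
      · simp [b, Finset.sum_ite_mem, hspos.ne']
    have hb1 := hs.2 b hb fun v hv => if_neg hv
    refine ⟨H b, ?_, ?_⟩
    · rw [mem_compl_singleton_iff, ← norm_ne_zero_iff, hb1]; exact one_ne_zero
    · simp only [mem_preimage, R, hb1, inv_one, one_smul, hc.leftInvOn hb]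
      intro v hv
      simp only [b, if_pos hv]
      positivity
  have hsuppR : ∀ w ∈ U, weightSupport (R w) = s := by
    rintro w ⟨hw, hws⟩
    refine (Finset.eq_of_subset_of_card_le (fun v hv => mem_weightSupport.2 (hws v hv).ne')
      (hmax _ (Finset.mem_filter.2 ⟨Finset.mem_univ _, ?_⟩))).symm
    refine weightSupport_mem_boundaryFaces hc (hc.mapsTo_symm (hball hw)) ?_
    rw [hc.rightInvOn (hball hw), hunit w hw]
  have hzero : ∀ w ∈ U, ∀ v, v ∉ s → R w v = 0 := fun w hw v hv => by
    rw [← hsuppR w hw, mem_weightSupport, not_not] at hv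
    exact hv
  have hsum : ∀ w ∈ U, ∑ v : s, R w v = 1 := fun w hw => by
    rw [Finset.sum_coe_sort s (R w), ← (hc.mapsTo_symm (hball hw.1)).1.2]
    exact Finset.sum_subset (Finset.subset_univ _) fun v _ hv => hzero w hw v hv
  have key := le_card_of_injOn (EuclideanSpace.equiv (Fin n) ℝ) (ι := s)
    (φ := fun w v => ‖w‖ * R w v) hU hUne ?_ ?_
  · simpa using key
  · refine continuousOn_pi.2 fun v => continuousOn_id.norm.mul ?_
    exact (continuous_apply (v : V)).comp_continuousOn (hR.mono inter_subset_left)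
  · intro w hw w' hw' hww
    have hnorm : ‖w‖ = ‖w'‖ := by
      have := congrArg (fun f : s → ℝ => ∑ v, f v) hww
      simpa only [← Finset.mul_sum, hsum w hw, hsum w' hw', mul_one] using this
    have hwn : ‖w‖ ≠ 0 := norm_ne_zero_iff.2 hw.1
    have hRR : R w = R w' := by
      funext v
      by_cases hv : v ∈ s
      · have := congrFun hww ⟨v, hv⟩
        simp only [← hnorm] at this
        exact mul_left_cancel₀ hwn this
      · rw [hzero w hw v hv, hzero w' hw' v hv]
    have h2 := hc.rightInvOn.injOn (hball hw.1) (hball hw'.1) hRR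
    simp only [← hnorm] at h2
    exact smul_right_injective _ (inv_ne_zero hwn) h2

end

/-! ### Composing charts and rounding unit spheres -/

theorem IsChart.trans {E F G : Type*} [TopologicalSpace E] [TopologicalSpace F]
    [TopologicalSpace G] {X : Set E} {Y : Set F} {Z : Set G} {H : E → F} {K : F → E} {H' : F → G}
    {K' : G → F} (h : IsChart X Y H K) (h' : IsChart Y Z H' K') :
    IsChart X Z (H' ∘ H) (K ∘ K') where
  continuousOn := h'.continuousOn.comp h.continuousOn h.mapsTo
  continuousOn_symm := h.continuousOn_symm.comp h'.continuousOn_symm h'.mapsTo_symm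
  mapsTo := h'.mapsTo.comp h.mapsTo
  mapsTo_symm := h.mapsTo_symm.comp h'.mapsTo_symm
  leftInvOn x hx := by simp [h'.leftInvOn (h.mapsTo hx), h.leftInvOn hx]
  rightInvOn x hx := by simp [h.rightInvOn (h'.mapsTo_symm hx), h'.rightInvOn hx]

/-- Radial projection identifies the unit spheres of linearly isomorphic normed spaces. -/
theorem ContinuousLinearEquiv.isChart_sphere.{u} {E F : Type u} [NormedAddCommGroup E] [NormedSpace ℝ E]
    [NormedAddCommGroup F] [NormedSpace ℝ F] (A : E ≃L[ℝ] F) :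
    IsChart (sphere (0 : E) 1) (sphere (0 : F) 1) (fun x => ‖A x‖⁻¹ • A x)
      (fun y => ‖A.symm y‖⁻¹ • A.symm y) := by
  have hcont : ∀ {E F : Type u} [NormedAddCommGroup E] [NormedSpace ℝ E]
      [NormedAddCommGroup F] [NormedSpace ℝ F] (A : E ≃L[ℝ] F),
      ContinuousOn (fun x => ‖A x‖⁻¹ • A x) (sphere (0 : E) 1) := by
    intro E F _ _ _ _ A
    refine ContinuousOn.smul (ContinuousOn.inv₀ A.continuous.norm.continuousOn fun x hx => ?_)
      A.continuous.continuousOn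
    simpa using ne_zero_of_mem_unit_sphere (⟨x, hx⟩ : sphere (0 : E) 1)
  have hmaps : ∀ {E F : Type u} [NormedAddCommGroup E] [NormedSpace ℝ E]
      [NormedAddCommGroup F] [NormedSpace ℝ F] (A : E ≃L[ℝ] F),
      MapsTo (fun x => ‖A x‖⁻¹ • A x) (sphere (0 : E) 1) (sphere (0 : F) 1) := by
    intro E F _ _ _ _ A x hx
    have : ‖A x‖ ≠ 0 := by simpa using ne_zero_of_mem_unit_sphere (⟨x, hx⟩ : sphere (0 : E) 1)
    simp [norm_smul, this]
  have hinv : ∀ {E F : Type u} [NormedAddCommGroup E] [NormedSpace ℝ E]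
      [NormedAddCommGroup F] [NormedSpace ℝ F] (A : E ≃L[ℝ] F),
      LeftInvOn (fun y => ‖A.symm y‖⁻¹ • A.symm y) (fun x => ‖A x‖⁻¹ • A x) (sphere (0 : E) 1) := by
    intro E F _ _ _ _ A x hx
    have h : ‖A x‖ ≠ 0 := by simpa using ne_zero_of_mem_unit_sphere (⟨x, hx⟩ : sphere (0 : E) 1)
    have h1 : ‖x‖ = 1 := by simpa using hx
    simp [norm_smul, h1, smul_smul, h]
  exact ⟨hcont A, hcont A.symm, hmaps A, hmaps A.symm, hinv A, hinv A.symm⟩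

/-- The coordinates of `ℝ^n × ℝ`, the last factor first. -/
noncomputable def prodCoords (n : ℕ) : (EuclideanSpace ℝ (Fin n) × ℝ) ≃L[ℝ] (Fin (n + 1) → ℝ) :=
  LinearEquiv.toContinuousLinearEquiv
    { toFun := fun z => Fin.cons z.2 z.1
      invFun := fun x => (WithLp.toLp 2 fun i => x i.succ, x 0)
      left_inv := fun z => by ext <;> simp
      right_inv := fun x => by
        funext i
        refine Fin.cases ?_ (fun j => ?_) i <;> simp
      map_add' := fun z z' => by
        funext i
        refine Fin.cases ?_ (fun j => ?_) i <;> simp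
      map_smul' := fun c z => by
        funext i
        refine Fin.cases ?_ (fun j => ?_) i <;> simp }

theorem firstReflection_prodCoords (n : ℕ) (w : EuclideanSpace ℝ (Fin n)) (t : ℝ) :
    firstReflection n (prodCoords n (w, t)) = prodCoords n (w, -t) := by
  funext i
  refine Fin.cases ?_ (fun j => ?_) i
  · rw [firstReflection_apply_zero]; rfl
  · rw [firstReflection_apply_succ]; rfl

/-! ### The boundary of the prism as a sphere -/

section
variable {V : Type*} [Fintype V] [LinearOrder V] {D : AbstractSimplicialComplex V} {n L : ℕ}
  {H : (V → ℝ) → EuclideanSpace ℝ (Fin n)} {K : EuclideanSpace ℝ (Fin n) → V → ℝ}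

/-- The faces of the staircase triangulation of the boundary of the prism over `D`. -/
def IsPrismFace (D : AbstractSimplicialComplex V) (H : (V → ℝ) → EuclideanSpace ℝ (Fin n))
    (s : Finset (V × Fin (L + 1))) : Prop :=
  s.image Prod.fst ∈ D.faces ∧ (∀ a ∈ s, ∀ b ∈ s, (a.2 : ℕ) ≤ b.2 + 1) ∧
    (∀ a ∈ s, ∀ b ∈ s, a.2 < b.2 → a.1 ≤ b.1) ∧
    (s.image Prod.fst ∈ boundaryFaces D H ∨ (∀ a ∈ s, a.2 = 0) ∨ ∀ a ∈ s, a.2 = Fin.last L)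

theorem IsPrismFace.subset {s t : Finset (V × Fin (L + 1))} (hs : IsPrismFace D H s) (hts : t ⊆ s)
    (ht : t.Nonempty) : IsPrismFace D H t := by
  have hsub := Finset.image_subset_image (f := Prod.fst) hts
  refine ⟨AbstractSimplicialComplex.mem_faces_of_subset hs.1 hsub (ht.image _),
    fun a ha b hb => hs.2.1 a (hts ha) b (hts hb),
    fun a ha b hb => hs.2.2.1 a (hts ha) b (hts hb), ?_⟩
  rcases hs.2.2.2 with h | h | h
  · exact Or.inl (mem_boundaryFaces_of_subset h hsub (ht.image _))
  · exact Or.inr (Or.inl fun a ha => h a (hts ha))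
  · exact Or.inr (Or.inr fun a ha => h a (hts ha))

theorem weightSupport_prismProj {x : V × Fin (L + 1) → ℝ} (hx : x ∈ stdSimplex ℝ _) :
    weightSupport (prismProj x) = (weightSupport x).image Prod.fst := by
  ext v
  rw [mem_weightSupport, Finset.mem_image, prismProj, ne_eq,
    Finset.sum_eq_zero_iff_of_nonneg fun i _ => hx.1 _]
  simp [mem_weightSupport]

/-- The map from the prism boundary to the unit sphere of `ℝ^n × ℝ` induced by a chart of `D`. -/
noncomputable def prismChart (L : ℕ) (H : (V → ℝ) → EuclideanSpace ℝ (Fin n))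
    (x : V × Fin (L + 1) → ℝ) : EuclideanSpace ℝ (Fin n) × ℝ :=
  (H (prismProj x), prismHeight x * (2 / L) - 1)

/-- The inverse of `prismChart`. -/
noncomputable def prismChartSymm (L : ℕ) (K : EuclideanSpace ℝ (Fin n) → V → ℝ)
    (z : EuclideanSpace ℝ (Fin n) × ℝ) : V × Fin (L + 1) → ℝ :=
  prismLift L (K z.1) ((z.2 + 1) * (L / 2))

/-- The product norm is the maximum, so a unit vector `(w, t)` has `‖w‖ = 1` or `t = -1` or `t = 1`:
the side and the two ends, which are the three alternatives in `IsPrismFace`. The height `[0, L]` is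
rescaled to `[-1, 1]`. -/
theorem isChart_prismChart (hL : 1 ≤ L)
    (hc : IsChart (realization D) (closedBall (0 : EuclideanSpace ℝ (Fin n)) 1) H K) :
    IsChart {x : V × Fin (L + 1) → ℝ | x ∈ stdSimplex ℝ _ ∧ IsPrismFace D H (weightSupport x)}
      (sphere (0 : EuclideanSpace ℝ (Fin n) × ℝ) 1) (prismChart L H) (prismChartSymm L K) := by
  have hL0 : (0 : ℝ) < L := by exact_mod_cast hL
  have hproj : MapsTo prismProj {x : V × Fin (L + 1) → ℝ | x ∈ stdSimplex ℝ _ ∧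
      IsPrismFace D H (weightSupport x)} (realization D) := fun x hx =>
    mem_realization_iff.2 ⟨prismProj_mem_stdSimplex hx.1, by
      rw [weightSupport_prismProj hx.1]; exact hx.2.1⟩
  have hsph : ∀ z ∈ sphere (0 : EuclideanSpace ℝ (Fin n) × ℝ) 1,
      z.1 ∈ closedBall (0 : EuclideanSpace ℝ (Fin n)) 1 ∧ 0 ≤ (z.2 + 1) * (L / 2) ∧
        (z.2 + 1) * (L / 2) ≤ L ∧ (‖z.1‖ = 1 ∨ (z.2 + 1) * (L / 2) = 0 ∨ (z.2 + 1) * (L / 2) = L) := by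
    intro z hz
    rw [mem_sphere_zero_iff_norm, Prod.norm_def] at hz
    have h1 : ‖z.1‖ ≤ 1 := hz ▸ le_max_left _ _
    have h2 : ‖z.2‖ ≤ 1 := hz ▸ le_max_right _ _
    rw [Real.norm_eq_abs, abs_le] at h2
    refine ⟨by simpa using h1, by have : 0 ≤ z.2 + 1 := by linarith
                                  positivity, by nlinarith, ?_⟩
    rcases max_choice ‖z.1‖ ‖z.2‖ with h | h
    · exact Or.inl (h ▸ hz)
    · rw [hz, Real.norm_eq_abs, eq_comm, abs_eq zero_le_one] at h
      rcases h with h | h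
      · right; right; rw [h]; ring
      · right; left; rw [h]; ring
  have hKz : ∀ z ∈ sphere (0 : EuclideanSpace ℝ (Fin n) × ℝ) 1, K z.1 ∈ realization D :=
    fun z hz => hc.mapsTo_symm (hsph z hz).1
  refine ⟨?_, ?_, ?_, ?_, ?_, ?_⟩
  · refine (hc.continuousOn.comp continuous_prismProj.continuousOn hproj).prodMk ?_
    exact ((continuous_prismHeight.mul continuous_const).sub continuous_const).continuousOn
  · refine continuous_prismLift.comp_continuousOn (ContinuousOn.prodMk ?_ (by fun_prop))
    exact hc.continuousOn_symm.comp continuousOn_fst fun z hz => (hsph z hz).1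
  · intro x hx
    have h1 : ‖H (prismProj x)‖ ≤ 1 := by simpa using hc.mapsTo (hproj hx)
    obtain ⟨h2, h3⟩ := prismHeight_mem_Icc hx.1
    have h4 : |prismHeight x * (2 / L) - 1| ≤ 1 := by
      rw [abs_le]
      constructor
      · have : 0 ≤ prismHeight x * (2 / L) := by positivity
        linarith
      · have : prismHeight x * (2 / L) ≤ L * (2 / L) := by gcongr
        rw [mul_div_cancel₀ _ hL0.ne'] at this
        linarith
    rw [mem_sphere_zero_iff_norm, Prod.norm_def]
    simp only [prismChart]
    rcases hx.2.2.2.2 with h | h | h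
    · rw [← weightSupport_prismProj hx.1] at h
      rw [h.2 _ (hproj hx) fun v hv => by simpa [mem_weightSupport] using hv]
      exact max_eq_left h4
    · have : prismHeight x = 0 := Finset.sum_eq_zero fun a _ => by
        by_cases ha : x a = 0
        · simp [ha]
        · simp [h a (mem_weightSupport.2 ha)]
      simpa [this] using h1
    · have : prismHeight x = L := by
        rw [prismHeight, ← one_mul (L : ℝ), ← hx.1.2, Finset.sum_mul]
        refine Finset.sum_congr rfl fun a _ => ?_
        by_cases ha : x a = 0
        · simp [ha]
        · simp [h a (mem_weightSupport.2 ha)]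
      rw [this, mul_div_cancel₀ _ hL0.ne']
      norm_num
      exact h1
  · intro z hz
    obtain ⟨h1, h2, h3, h4⟩ := hsph z hz
    have hK := hKz z hz
    have hst := prismLift_mem_stdSimplex (L := L) hK.1 h2 h3
    have himg : (weightSupport (prismChartSymm L K z)).image Prod.fst = weightSupport (K z.1) := by
      rw [prismChartSymm, ← weightSupport_prismProj hst, prismProj_prismLift hK.1 h2 h3]
    refine ⟨hst, ?_, ?_, ?_, ?_⟩
    · rw [himg]; exact (mem_realization_iff.1 hK).2
    · intro a ha b hb
      exact prismLift_spread hK.1 (mem_weightSupport.1 ha) (mem_weightSupport.1 hb)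
    · intro a ha b hb
      exact prismLift_le_of_lt hK.1 (mem_weightSupport.1 ha) (mem_weightSupport.1 hb)
    · rcases h4 with h | h | h
      · left
        rw [himg]
        exact weightSupport_mem_boundaryFaces hc hK (by rw [hc.rightInvOn h1, h])
      · right; left
        intro a ha
        have h5 := (lt_of_prismLift_ne_zero hK.1 (mem_weightSupport.1 ha)).1
        rw [h] at h5
        have h6 := (sum_filter_mem_Icc hK.1 (Finset.univ.filter (· ≤ a.1))).2
        have : ((a.2 : ℕ) : ℝ) < ((1 : ℕ) : ℝ) := by push_cast; linarith
        have := Nat.cast_lt.1 this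
        exact Fin.ext (by rw [Fin.val_zero]; omega)
      · right; right
        intro a ha
        have h5 := (lt_of_prismLift_ne_zero hK.1 (mem_weightSupport.1 ha)).2
        rw [h] at h5
        have h6 := (sum_filter_mem_Icc hK.1 (Finset.univ.filter (· < a.1))).1
        have : ((L : ℕ) : ℝ) < ((a.2 + 1 : ℕ) : ℝ) := by push_cast; linarith
        have := Nat.cast_lt.1 this
        have := a.2.is_lt
        exact Fin.ext (by simp; omega)
  · intro x hx
    have : (prismHeight x * (2 / L) - 1 + 1) * ((L : ℝ) / 2) = prismHeight x := by
      field_simp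
      ring
    simp only [prismChartSymm, prismChart, this, hc.leftInvOn (hproj hx)]
    exact prismLift_proj_height hx.1
      (fun a b ha hb => hx.2.2.1 a (mem_weightSupport.2 ha) b (mem_weightSupport.2 hb))
      (fun a b ha hb => hx.2.2.2.1 a (mem_weightSupport.2 ha) b (mem_weightSupport.2 hb))
  · intro z hz
    obtain ⟨h1, h2, h3, -⟩ := hsph z hz
    have hK := hKz z hz
    simp only [prismChart, prismChartSymm, prismProj_prismLift hK.1 h2 h3,
      prismHeight_prismLift hK.1 h2 h3, hc.rightInvOn h1]
    refine Prod.ext rfl ?_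
    simp only
    field_simp
    ring

end

/-! ### The prism complex, its ends and its layers -/

section
variable {V : Type*} [Fintype V] [LinearOrder V] {D : AbstractSimplicialComplex V} {n L : ℕ}
  {H : (V → ℝ) → EuclideanSpace ℝ (Fin n)} {K : EuclideanSpace ℝ (Fin n) → V → ℝ}

/-- The complex of prism faces, with its vertices reindexed along `ι`. -/
def prismComplex {k : ℕ} (D : AbstractSimplicialComplex V)
    (H : (V → ℝ) → EuclideanSpace ℝ (Fin n)) (ι : Fin k ↪ V × Fin (L + 1))
    (hι : ∀ a, IsPrismFace D H {ι a}) : AbstractSimplicialComplex (Fin k) where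
  faces := {s | IsPrismFace D H (s.map ι)}
  isRelLowerSet_faces := fun s hs =>
    ⟨Finset.map_nonempty.1 (Finset.image_nonempty.1 (D.isRelLowerSet_faces hs.1).1),
      fun _ hts ht => hs.subset (Finset.map_subset_map.2 hts) (ht.map)⟩
  singleton_mem a := by
    change IsPrismFace D H (({a} : Finset (Fin k)).map ι)
    rw [Finset.map_singleton]
    exact hι a

theorem continuous_extend_zero {α β : Type*} (ι : α ↪ β) :
    Continuous fun x : α → ℝ => Function.extend ι x (0 : β → ℝ) := by
  refine continuous_pi fun b => ?_
  by_cases hb : ∃ a, ι a = b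
  · obtain ⟨a, rfl⟩ := hb
    simp only [ι.injective.extend_apply]
    fun_prop
  · simp only [Function.extend_apply' _ _ _ hb]
    fun_prop

theorem sum_extend_zero {α β : Type*} [Fintype α] [Fintype β] (ι : α ↪ β) (x : α → ℝ) :
    ∑ b, Function.extend ι x (0 : β → ℝ) b = ∑ a, x a := by
  classical
  rw [← Finset.sum_subset (Finset.subset_univ (Finset.univ.map ι)), Finset.sum_map]
  · simp only [ι.injective.extend_apply]
  · intro b _ hb
    exact Function.extend_apply' _ _ _ fun ⟨a, ha⟩ =>
      hb (Finset.mem_map.2 ⟨a, Finset.mem_univ _, ha⟩)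

theorem weightSupport_extend_zero {α β : Type*} [Fintype α] [Fintype β] (ι : α ↪ β) (x : α → ℝ) :
    weightSupport (Function.extend ι x (0 : β → ℝ)) = (weightSupport x).map ι := by
  ext b
  rw [mem_weightSupport, Finset.mem_map]
  by_cases hb : ∃ a, ι a = b
  · obtain ⟨a, rfl⟩ := hb
    simp [ι.injective.extend_apply, mem_weightSupport]
  · rw [Function.extend_apply' _ _ _ hb]
    simp only [Pi.zero_apply, ne_eq, not_true_eq_false, false_iff]
    exact fun ⟨a, _, ha⟩ => hb ⟨a, ha⟩

/-- Prism points that are not vertices of the boundary, such as interior vertices of `D` at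
intermediate levels, carry no weight, so leaving them out of the vertex set loses nothing. -/
theorem isChart_extend {k : ℕ} (ι : Fin k ↪ V × Fin (L + 1)) (hι : ∀ a, IsPrismFace D H {ι a})
    (hsurj : ∀ b, IsPrismFace D H {b} → b ∈ range ι) :
    IsChart (realization (prismComplex D H ι hι))
      {x : V × Fin (L + 1) → ℝ | x ∈ stdSimplex ℝ _ ∧ IsPrismFace D H (weightSupport x)}
      (fun x => Function.extend ι x 0) (fun y a => y (ι a)) := by
  have hext : ∀ y : V × Fin (L + 1) → ℝ, IsPrismFace D H (weightSupport y) →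
      Function.extend ι (fun a => y (ι a)) 0 = y := by
    intro y hy
    funext b
    by_cases hb : b ∈ range ι
    · obtain ⟨a, rfl⟩ := hb
      rw [ι.injective.extend_apply]
    · rw [Function.extend_apply' _ _ _ hb]
      by_contra hne
      refine hb (hsurj b (hy.subset (Finset.singleton_subset_iff.2 (mem_weightSupport.2 ?_))
        (Finset.singleton_nonempty b)))
      exact fun h => hne (by simp [h])
  refine ⟨(continuous_extend_zero ι).continuousOn, by fun_prop, ?_, ?_, ?_, ?_⟩
  · intro x hx
    obtain ⟨hx, hxf⟩ := mem_realization_iff.1 hx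
    refine ⟨⟨fun b => ?_, by rw [sum_extend_zero, hx.2]⟩, ?_⟩
    · by_cases hb : ∃ a, ι a = b
      · obtain ⟨a, rfl⟩ := hb
        simpa only [ι.injective.extend_apply] using hx.1 a
      · simp [Function.extend_apply' _ _ _ hb]
    · rw [weightSupport_extend_zero]; exact hxf
  · rintro y ⟨hy, hyf⟩
    refine mem_realization_iff.2 ⟨⟨fun a => hy.1 _, ?_⟩, ?_⟩
    · rw [← sum_extend_zero ι, hext y hyf, hy.2]
    · change IsPrismFace D H _
      rw [← weightSupport_extend_zero, hext y hyf]
      exact hyf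
  · intro x _
    funext a
    exact ι.injective.extend_apply _ _ _
  · rintro y ⟨-, hyf⟩
    exact hext y hyf

theorem extend_simplexWeights {α β : Type*} [DecidableEq α] [DecidableEq β] (ι : α ↪ β) {N : ℕ}
    (t : Fin N → α) (x : Fin N → ℝ) :
    Function.extend ι (simplexWeights t x) (0 : β → ℝ) = simplexWeights (fun i => ι (t i)) x := by
  funext b
  by_cases hb : ∃ a, ι a = b
  · obtain ⟨a, rfl⟩ := hb
    rw [ι.injective.extend_apply]
    simp [simplexWeights, Finset.sum_apply, Pi.single_apply]
  · rw [Function.extend_apply' _ _ _ hb, simplexWeights_apply_of_notMem]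
    · rfl
    · rintro ⟨i, hi⟩
      exact hb ⟨_, hi⟩

theorem prismProj_simplexWeights {V : Type*} [DecidableEq V] {N : ℕ} (t : Fin N → V) (c : Fin (L + 1)) (x : Fin N → ℝ) :
    prismProj (simplexWeights (fun i => (t i, c)) x) = simplexWeights t x := by
  funext v
  simp only [prismProj, simplexWeights, Finset.sum_apply, Pi.smul_apply, smul_eq_mul]
  rw [Finset.sum_comm]
  refine Finset.sum_congr rfl fun i _ => ?_
  rw [← Finset.mul_sum]
  simp [Pi.single_apply, Prod.ext_iff, ite_and]

theorem prismHeight_simplexWeights {N : ℕ} (t : Fin N → V) (c : Fin (L + 1)) (x : Fin N → ℝ) :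
    prismHeight (simplexWeights (fun i => (t i, c)) x) = (c : ℝ) * ∑ i, x i := by
  simp only [prismHeight, simplexWeights, Finset.sum_apply, Pi.smul_apply, smul_eq_mul,
    Finset.sum_mul]
  rw [Finset.sum_comm, Finset.mul_sum]
  refine Finset.sum_congr rfl fun i _ => ?_
  rw [Finset.sum_eq_single (t i, c)]
  · simp [mul_comm]
  · intro b _ hb
    simp [hb]
  · simp

theorem isPrismFace_level {s : Finset V} (hs : s ∈ D.faces) {c : Fin (L + 1)}
    (hc : c = 0 ∨ c = Fin.last L) : IsPrismFace D H (s.image fun v => (v, c)) := by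
  have hlev : ∀ a ∈ s.image fun v => (v, c), a.2 = c := by
    intro a ha
    obtain ⟨v, -, rfl⟩ := Finset.mem_image.1 ha
    rfl
  refine ⟨?_, fun a ha b hb => ?_, fun a ha b hb hab => ?_, Or.inr ?_⟩
  · rw [Finset.image_image]
    simpa [Function.comp_def] using hs
  · rw [hlev a ha, hlev b hb]; omega
  · rw [hlev a ha, hlev b hb] at hab
    exact absurd hab (lt_irrefl _)
  · rcases hc with rfl | rfl
    · exact Or.inl hlev
    · exact Or.inr hlev

/-- The top-dimensional simplex of the `i`-th layer over a boundary simplex `s` whose first vertex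
is `v`. -/
def layerSimplex (s : Finset V) (v : V) (i : Fin L) : Finset (V × Fin (L + 1)) :=
  insert (v, i.castSucc) (s.image fun u => (u, i.succ))

/-- The only vertex on the lower level is `v`, the least vertex of `s`, so the staircase condition
holds. -/
theorem isPrismFace_layerSimplex {s : Finset V} (hs : s ∈ boundaryFaces D H) {v : V} (hv : v ∈ s)
    (hmin : ∀ u ∈ s, v ≤ u) (i : Fin L) : IsPrismFace D H (layerSimplex s v i) := by
  have hmem : ∀ a ∈ layerSimplex s v i, a = (v, i.castSucc) ∨ a.1 ∈ s ∧ a.2 = i.succ := by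
    intro a ha
    rcases Finset.mem_insert.1 ha with h | h
    · exact Or.inl h
    · obtain ⟨u, hu, rfl⟩ := Finset.mem_image.1 h
      exact Or.inr ⟨hu, rfl⟩
  have himg : (layerSimplex s v i).image Prod.fst = s := by
    rw [layerSimplex, Finset.image_insert, Finset.image_image]
    simpa [Function.comp_def] using hv
  refine ⟨by rw [himg]; exact hs.1, fun a ha b hb => ?_, fun a ha b hb hab => ?_, Or.inl (by rwa [himg])⟩
  · rcases hmem a ha with rfl | ⟨-, h⟩ <;> rcases hmem b hb with rfl | ⟨-, h'⟩ <;> simp [*]; omega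
  · rcases hmem a ha with rfl | ⟨h, h2⟩ <;> rcases hmem b hb with rfl | ⟨h', h2'⟩
    · exact absurd hab (lt_irrefl _)
    · exact hmin _ h'
    · rw [h2, Fin.lt_def] at hab
      simp at hab
    · rw [h2, h2'] at hab
      exact absurd hab (lt_irrefl _)

theorem card_layerSimplex {V : Type*} [LinearOrder V] (s : Finset V) (v : V) (i : Fin L) :
    (layerSimplex s v i).card = s.card + 1 := by
  rw [layerSimplex, Finset.card_insert_of_notMem, Finset.card_image_of_injective]
  · intro u w h; exact congrArg Prod.fst h
  · intro h
    obtain ⟨u, -, hu⟩ := Finset.mem_image.1 h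
    have := congrArg (fun a => (a.2 : ℕ)) hu
    simp at this

end

/-! ### The sphere, the two copies and the additional simplices -/

theorem lemma2p2 (n : ℕ) (hn : 1 ≤ n) {V : Type*} [Fintype V] (D : AbstractSimplicialComplex V)
    (hD : IsTriangulatedDisc n D) (m : ℕ) (hm : 1 ≤ m) :
    ∃ (k : ℕ) (S : AbstractSimplicialComplex (Fin k)) (f g : V ↪ Fin k),
      IsTriangulatedSphere n S ∧
      IsCopy D S f ∧ IsCopy D S g ∧
      Disjoint (Set.range f) (Set.range g) ∧
      OppositelyOriented n D S f g ∧
      m ≤ (additionalSimplices n D S f g).ncard := by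
  classical
  let _ : LinearOrder V := LinearOrder.lift' (Fintype.equivFin V) (Equiv.injective _)
  obtain ⟨h⟩ := hD
  obtain ⟨H, K, hc⟩ := h.exists_isChart
  -- Every vertex of an `AbstractSimplicialComplex` must be a face, so only actual vertices of the
  -- prism boundary are kept. The prism has `m` layers, one for each additional simplex.
  set W := {b : V × Fin (m + 1) // IsPrismFace D H {b}}
  set k := Fintype.card W
  set ι : Fin k ↪ V × Fin (m + 1) :=
    (Fintype.equivFin W).symm.toEmbedding.trans (Function.Embedding.subtype _)
  have hι : ∀ a, IsPrismFace D H {ι a} := fun a => ((Fintype.equivFin W).symm a).2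
  have hιW : ∀ b (hb : IsPrismFace D H {b}), ι (Fintype.equivFin W ⟨b, hb⟩) = b := fun b hb => by
    simp [ι]
    rfl
  have hsurj : ∀ b, IsPrismFace D H {b} → b ∈ range ι := fun b hb => ⟨_, hιW b hb⟩
  set S := prismComplex D H ι hι
  have hend : ∀ (v : V) (c : Fin (m + 1)), c = 0 ∨ c = Fin.last m → IsPrismFace D H {(v, c)} := by
    intro v c hcc
    simpa using isPrismFace_level (H := H) (D.singleton_mem v) hcc
  -- the two copies of the disc at the ends of the prism
  have hcopy : ∀ c : Fin (m + 1), c = 0 ∨ c = Fin.last m →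
      ∃ f : V ↪ Fin k, (∀ v, ι (f v) = (v, c)) ∧ IsCopy D S f := by
    intro c hcc
    refine ⟨⟨fun v => Fintype.equivFin W ⟨(v, c), hend v c hcc⟩, fun u v huv => ?_⟩,
      fun v => hιW _ _, fun s hs => ?_⟩
    · have := (Fintype.equivFin W).injective huv
      exact congrArg Prod.fst (congrArg Subtype.val this)
    · change IsPrismFace D H _
      convert isPrismFace_level (H := H) hs hcc using 1
      ext b
      simp only [Finset.mem_map, Finset.mem_image]
      constructor
      · rintro ⟨_, ⟨v, hv, rfl⟩, rfl⟩
        exact ⟨v, hv, (hιW _ _).symm⟩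
      · rintro ⟨v, hv, rfl⟩
        exact ⟨_, ⟨v, hv, rfl⟩, hιW _ _⟩
  obtain ⟨f, hf, hfS⟩ := hcopy 0 (Or.inl rfl)
  obtain ⟨g, hg, hgS⟩ := hcopy (Fin.last m) (Or.inr rfl)
  have hm0 : (0 : ℝ) < m := by exact_mod_cast hm
  have h0m : (0 : Fin (m + 1)) ≠ Fin.last m := fun h => by
    have := congrArg Fin.val h
    simp at this
    omega
  have hchart := (isChart_extend ι hι hsurj).trans (isChart_prismChart hm hc)
  refine ⟨k, S, f, g, ?_, hfS, hgS, ?_, ?_, ?_⟩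
  · exact ⟨(hchart.trans ((prodCoords n).trans
      (EuclideanSpace.equiv (Fin (n + 1)) ℝ).symm).isChart_sphere).homeomorph⟩
  · rw [Set.disjoint_left]
    rintro _ ⟨u, rfl⟩ ⟨v, hv⟩
    have := hg v
    rw [hv, hf] at this
    exact h0m (congrArg Prod.snd this)
  · have hnorm : ∀ x ∈ realization S, ‖(prismChart m H ∘ fun x => Function.extend ι x 0) x‖ = 1 :=
      fun x hx => by simpa using hchart.mapsTo hx
    refine ⟨_, isOrientation_simplexSign hn (prodCoords n) hchart.continuousOn
      hchart.leftInvOn.injOn hnorm, fun t ht => ?_⟩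
    refine simplexSign_of_reflection (prodCoords n) hchart.continuousOn hchart.leftInvOn.injOn
      hnorm ?_ fun x _ hx1 => ?_
    · obtain ⟨hinj, s, hs, hst⟩ := ht
      exact ⟨f.injective.comp hinj, _, hfS s hs, by rw [Finset.coe_map, hst, range_comp]⟩
    · have key : ∀ (f : V ↪ Fin k) (c : Fin (m + 1)), (∀ v, ι (f v) = (v, c)) →
          (prismChart m H ∘ fun x => Function.extend ι x 0) (simplexWeights (f ∘ t) x)
            = (H (simplexWeights t x), (c : ℝ) * (2 / m) - 1) := by
        intro f c hfc
        simp only [Function.comp_apply, extend_simplexWeights, hfc, prismChart,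
          prismProj_simplexWeights, prismHeight_simplexWeights, hx1, mul_one]
      -- Level `0` goes to height `-1` and level `m` to height `1`, so corresponding points of the
      -- two ends are mirror images.
      rw [key f 0 hf, key g _ hg, firstReflection_prodCoords]
      congr 2
      simp only [Fin.val_last, Fin.val_zero, Nat.cast_zero]
      field_simp
      ring
  · obtain ⟨s, hs, hscard⟩ := exists_mem_boundaryFaces_card hn hc
    obtain ⟨v, hv, hmin⟩ := Finset.exists_min_image s id (Finset.card_pos.1 (by omega))
    have hpre : ∀ i : Fin m, ∃ T : Finset (Fin k), T.map ι = layerSimplex s v i := by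
      intro i
      refine ⟨Finset.univ.filter fun a => ι a ∈ layerSimplex s v i, ?_⟩
      ext b
      simp only [Finset.mem_map, Finset.mem_filter, Finset.mem_univ, true_and]
      constructor
      · rintro ⟨a, ha, rfl⟩; exact ha
      · intro hb
        obtain ⟨a, rfl⟩ := hsurj b ((isPrismFace_layerSimplex hs hv hmin i).subset
          (Finset.singleton_subset_iff.2 hb) (Finset.singleton_nonempty b))
        exact ⟨a, hb, rfl⟩
    choose T hT using hpre
    have hlow : ∀ i, (v, i.castSucc) ∈ (T i).map ι := fun i => by
      rw [hT]; exact Finset.mem_insert_self _ _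
    have hupp : ∀ i, (v, i.succ) ∈ (T i).map ι := fun i => by
      rw [hT]; exact Finset.mem_insert_of_mem (Finset.mem_image_of_mem _ hv)
    have hnot : ∀ (f : V ↪ Fin k) (c : Fin (m + 1)), (∀ v, ι (f v) = (v, c)) →
        ∀ i, ∀ d ∈ D.faces, d.map f ≠ T i := by
      intro f c hfc i d _ hdT
      have hlev : ∀ b ∈ (T i).map ι, b.2 = c := by
        intro b hb
        rw [← hdT, Finset.map_map] at hb
        obtain ⟨u, -, rfl⟩ := Finset.mem_map.1 hb
        exact congrArg Prod.snd (hfc u)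
      -- The simplex contains `v` on two consecutive levels, while a copy of `D` lies on one level.
      have h1 := hlev _ (hlow i)
      have h2 := hlev _ (hupp i)
      have := congrArg Fin.val (h1.trans h2.symm)
      simp at this
    have hTinj : Function.Injective T := by
      intro i j hij
      have h1 := hlow i
      have h2 := hlow j
      have h3 := hupp i
      have h4 := hupp j
      rw [hij, hT] at h1 h3
      rw [← hij, hT] at h2 h4
      simp only [layerSimplex, Finset.mem_insert, Finset.mem_image, Prod.mk.injEq, Fin.ext_iff,
        Fin.val_succ, Fin.val_castSucc] at h1 h2 h3 h4
      -- The two levels on which `v` occurs determine the layer.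
      refine Fin.ext ?_
      grind
    calc m = (range T).ncard := by
          rw [← image_univ, ncard_image_of_injective _ hTinj, ncard_univ, Nat.card_fin]
      _ ≤ _ := by
          refine ncard_le_ncard ?_ (toFinite _)
          rintro _ ⟨i, rfl⟩
          refine ⟨?_, ?_, hnot f 0 hf i, hnot g _ hg i⟩
          · change IsPrismFace D H _
            rw [hT]
            exact isPrismFace_layerSimplex hs hv hmin i
          · rw [← Finset.card_map ι, hT, card_layerSimplex, hscard]
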